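/- \textbf{Model.} Finitely many places (threads) share a heap of items, an unbounded array $\mathrm{array}[0,1,2,\dots]$, initially null everywhere, and a counter $\mathrm{tail}$, initially $0$. An item stores the place that created it, a number $k$, a task, and a mutable tag. Every place $p$ also has its own index $\mathrm{head}_p$, initially $0$, and its own priority queue of pairs (position, item), initially empty. Tasks have totally preordered priorities, and a constant $k_{\max}\ge 1$ is fixed. Executions are arbitrary sequentially consistent interleavings of atomic steps, each with at most one access to mutable shared memory, of places that repeatedly invoke the following operations. $\mathtt{push}(k,a)$ by $p$, with $1\le k\le k_{\max}$: allocate a new item $x$ for $(p,k,a)$. Repeat: read $t=\mathrm{tail}$ and choose an arbitrary offset $o\in\{0,\dots,k-1\}$; for $j=0,\dots,k-1$ let $pos=t+((o+j)\bmod k)$, set the tag of $x$ to $pos$ and perform $\mathrm{CAS}(\mathrm{array}[pos],\text{null},x)$; after the first success add $(pos,x)$ to the queue of $p$ and return. If all $k$ attempts fail, perform $\mathrm{CAS}(\mathrm{tail},t,t+k)$ and repeat. $\mathtt{pop}()$ by $p$: (1) while $\mathrm{head}_p<\mathrm{tail}$, add $(\mathrm{head}_p,\mathrm{array}[\mathrm{head}_p])$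 to the queue of $p$ unless $p$ created that item, and increment $\mathrm{head}_p$. (2) If the queue of $p$ is not empty, remove a pair $(pos,x)$ of highest priority from it, read the task of $x$ and perform $\mathrm{CAS}(\text{tag of }x,pos,-1)$; on success return the task, on failure go back to (1). (3) If the queue is empty, let $t=\mathrm{head}_p$, which is the value of $\mathrm{tail}$ observed last, choose an arbitrary $o\in\{0,\dots,k_{\max}-1\}$ and probe $\mathrm{array}[t+o]$: if it holds an item $x$ whose $k$ exceeds $o$, read the task of $x$ and perform $\mathrm{CAS}(\text{tag of }x,t+o,-1)$; on success return the task. In all other cases return null. \textbf{Theorem.} (a) \emph{\texttt{pop} is lock-free.} A pending \texttt{pop} always has a next step. In every infinite execution with infinitely many steps of \texttt{pop} operations, infinitely many operations complete. If a single \texttt{pop} makes infinitely many steps without returning, then infinitely many operations of the other places complete successfully (\texttt{push} operations, or \texttt{pop} operations that return a task). (b) \emph{\texttt{pop} is linearizable and ignores at most $k$ items.} For every finite execution one can choose an order of all completed and some of the pending operations, and for each of them a linearization point between its invocation and its response, in accordance with the order, such that, executed sequentially in this order, every \texttt{push} adds a new item and every \texttt{pop} that returns a task removes a stored item with this task (so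 each item is returned at most once). Say that such a \texttt{pop} ignores the items which are stored when it takes effect and have a priority higher than that of the returned task, and that a \texttt{pop} returning null ignores all stored items. The order and the points can be chosen such that moreover: (i) if all \texttt{push} operations use the same value $k$, every \texttt{pop} ignores at most $k$ items; at its linearization point all of them are stored after the tail, that is, at the array positions $\mathrm{tail},\dots,\mathrm{tail}+k-1$, and they are among the last $k$ items pushed; (ii) if the values of $k$ vary, every \texttt{pop} that takes its task from its priority queue or returns null ignores at most $k_{\max}$ items, and at its linearization point they are all stored at the array positions $\mathrm{tail},\dots,\mathrm{tail}+k_{\max}-1$. -/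

import Mathlib

open Filter

namespace CentralK

/-- An item of the shared heap: its creator, its relaxation parameter, its task, and the mutable
`tag`, which holds the position of the item in the global array, or `-1` once the item is taken. -/
structure Item (P T : Type*) where
  place : P
  k : ℕ
  task : T
  tag : ℤ

/-- A reference held in a local priority queue: an array position and the address of an item. -/
structure ItemRef where
  tag : ℕ
  it : ℕ

/-- What a `pop` returns: nothing (`null`), or the task of an item. The address of the item, and
whether it was taken through the local priority queue or through the random probe behind `tail`,
are recorded for bookkeeping only. -/
inductive Outcome (T : Type*) where
  | empty : Outcome T
  | fromQueue (i : ℕ) (a : T) : Outcome T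
  | fromProbe (i : ℕ) (a : T) : Outcome T

/-- Program counters (with the local variables) of a place. -/
inductive PC (T : Type*) where
  | idle : PC T
  /-- about to execute `t = tail; offset = rand(0, k - 1)` for the item at address `i` -/
  | pushRead (i : ℕ) : PC T
  /-- about to execute `it.tag = pos` with `pos = t + (off + j) % k` -/
  | pushTag (i t off j : ℕ) : PC T
  /-- about to execute `CAS(global_array[pos], null, it)` with `pos = t + (off + j) % k` -/
  | pushCas (i t off j : ℕ) : PC T
  /-- about to execute `CAS(tail, t, t + k)` -/
  | pushTail (i t : ℕ) : PC T
  /-- the item is in the array at `pos`; about to enqueue its reference locally and to return -/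
  | pushRef (i pos : ℕ) : PC T
  /-- about to evaluate `place.head < tail` -/
  | popScan : PC T
  /-- about to read `global_array[place.head]` -/
  | popFetch : PC T
  /-- about to execute `place.prio_queue.pop()` -/
  | popSelect : PC T
  /-- about to execute `CAS(ref.it.tag, ref.tag, -1)`, the task `a` having been read -/
  | popCas (r : ItemRef) (a : T) : PC T
  /-- the local queue is empty; about to read the array `off` positions after the observed tail -/
  | popProbe (off : ℕ) : PC T
  /-- about to execute `CAS(it.tag, pos, -1)` on the probed item, its task `a` having been read -/
  | popProbeCas (pos i : ℕ) (a : T) : PC T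
  /-- about to return -/
  | popReturn (o : Outcome T) : PC T

/-- The place is executing a `pop`. -/
def PC.IsPop {T : Type*} : PC T → Prop
  | .popScan | .popFetch | .popSelect | .popCas _ _ | .popProbe _ | .popProbeCas _ _ _
  | .popReturn _ => True
  | _ => False

/-- The local component of a place. The priority queue is given by its contents. -/
structure Local (T : Type*) where
  head : ℕ
  queue : Multiset ItemRef
  pc : PC T

/-- Global states: the heap of items, the unbounded global array (`none` is `null`), `tail`, and
the local components. -/
structure State (P T : Type*) where
  heap : ℕ → Option (Item P T)
  array : ℕ → Option ℕ
  tail : ℕ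
  loc : P → Local T

/-- The empty data structure, all places idle. -/
def State.init (P T : Type*) : State P T where
  heap := fun _ => none
  array := fun _ => none
  tail := 0
  loc := fun _ => ⟨0, 0, .idle⟩

/-- Replace the local component of `p`. -/
def State.setLoc {P T : Type*} [DecidableEq P] (s : State P T) (p : P) (l : Local T) :
    State P T :=
  { s with loc := Function.update s.loc p l }

/-- Move the program counter of `p`. -/
def State.setPc {P T : Type*} [DecidableEq P] (s : State P T) (p : P) (c : PC T) : State P T :=
  s.setLoc p { s.loc p with pc := c }

/-- Overwrite the heap cell `i`. -/
def State.setItem {P T : Type*} (s : State P T) (i : ℕ) (it : Item P T) : State P T :=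
  { s with heap := Function.update s.heap i (some it) }

/-- Step labels: invocations, responses and internal steps. The address `i` of the item allocated
by a `push` is recorded for bookkeeping. -/
inductive Act (T : Type*) where
  | invPush (k : ℕ) (a : T) (i : ℕ) : Act T
  | retPush : Act T
  | invPop : Act T
  | retPop (o : Outcome T) : Act T
  | internal : Act T

/-- The response labels. -/
def Act.IsRet {T : Type*} : Act T → Prop
  | .retPush | .retPop _ => True
  | _ => False

/-- The responses of a `push` and of a `pop` that returns a task. -/
def Act.IsSuccess {T : Type*} : Act T → Prop
  | .retPush | .retPop (.fromQueue _ _) | .retPop (.fromProbe _ _) => True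
  | _ => False

/-- One atomic step of one place; `prio` gives the priorities of the tasks (larger is better) and
`kmax` bounds the parameter `k` of `push`. A null pointer has no transition. -/
inductive Step {P T Q : Type*} [DecidableEq P] [LinearOrder Q] (prio : T → Q) (kmax : ℕ) :
    State P T → P → Act T → State P T → Prop
  | pushInvoke (s : State P T) (p : P) (k : ℕ) (a : T) (i : ℕ)
      (hpc : (s.loc p).pc = .idle) (hk : 1 ≤ k) (hk' : k ≤ kmax) (hi : s.heap i = none) :
      Step prio kmax s p (.invPush k a i) ((s.setItem i ⟨p, k, a, -1⟩).setPc p (.pushRead i))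
  | pushRead (s : State P T) (p : P) (i off : ℕ) (it : Item P T)
      (hpc : (s.loc p).pc = .pushRead i) (hi : s.heap i = some it) (hoff : off < it.k) :
      Step prio kmax s p .internal (s.setPc p (.pushTag i s.tail off 0))
  | pushTag (s : State P T) (p : P) (i t off j : ℕ) (it : Item P T)
      (hpc : (s.loc p).pc = .pushTag i t off j) (hi : s.heap i = some it) :
      Step prio kmax s p .internal
        ((s.setItem i { it with tag := ((t + (off + j) % it.k : ℕ) : ℤ) }).setPc p
          (.pushCas i t off j))
  | pushCasOk (s : State P T) (p : P) (i t off j : ℕ) (it : Item P T)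
      (hpc : (s.loc p).pc = .pushCas i t off j) (hi : s.heap i = some it)
      (hnull : s.array (t + (off + j) % it.k) = none) :
      Step prio kmax s p .internal
        (State.setPc { s with array := Function.update s.array (t + (off + j) % it.k) (some i) } p
          (.pushRef i (t + (off + j) % it.k)))
  | pushCasNext (s : State P T) (p : P) (i t off j : ℕ) (it : Item P T)
      (hpc : (s.loc p).pc = .pushCas i t off j) (hi : s.heap i = some it)
      (hfull : s.array (t + (off + j) % it.k) ≠ none) (hj : j + 1 < it.k) :
      Step prio kmax s p .internal (s.setPc p (.pushTag i t off (j + 1)))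
  | pushCasLast (s : State P T) (p : P) (i t off j : ℕ) (it : Item P T)
      (hpc : (s.loc p).pc = .pushCas i t off j) (hi : s.heap i = some it)
      (hfull : s.array (t + (off + j) % it.k) ≠ none) (hj : it.k ≤ j + 1) :
      Step prio kmax s p .internal (s.setPc p (.pushTail i t))
  | pushTailOk (s : State P T) (p : P) (i t : ℕ) (it : Item P T)
      (hpc : (s.loc p).pc = .pushTail i t) (hi : s.heap i = some it) (ht : s.tail = t) :
      Step prio kmax s p .internal (State.setPc { s with tail := t + it.k } p (.pushRead i))
  | pushTailFail (s : State P T) (p : P) (i t : ℕ)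
      (hpc : (s.loc p).pc = .pushTail i t) (ht : s.tail ≠ t) :
      Step prio kmax s p .internal (s.setPc p (.pushRead i))
  | pushReturn (s : State P T) (p : P) (i pos : ℕ)
      (hpc : (s.loc p).pc = .pushRef i pos) :
      Step prio kmax s p .retPush
        (s.setLoc p ⟨(s.loc p).head, ⟨pos, i⟩ ::ₘ (s.loc p).queue, .idle⟩)
  | popInvoke (s : State P T) (p : P) (hpc : (s.loc p).pc = .idle) :
      Step prio kmax s p .invPop (s.setPc p .popScan)
  | popScanMore (s : State P T) (p : P)
      (hpc : (s.loc p).pc = .popScan) (hlt : (s.loc p).head < s.tail) :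
      Step prio kmax s p .internal (s.setPc p .popFetch)
  | popScanDone (s : State P T) (p : P)
      (hpc : (s.loc p).pc = .popScan) (hge : ¬ (s.loc p).head < s.tail) :
      Step prio kmax s p .internal (s.setPc p .popSelect)
  | popFetchOther (s : State P T) (p : P) (i : ℕ) (it : Item P T)
      (hpc : (s.loc p).pc = .popFetch) (ha : s.array (s.loc p).head = some i)
      (hi : s.heap i = some it) (hp : it.place ≠ p) :
      Step prio kmax s p .internal
        (s.setLoc p ⟨(s.loc p).head + 1, ⟨(s.loc p).head, i⟩ ::ₘ (s.loc p).queue, .popScan⟩)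
  | popFetchOwn (s : State P T) (p : P) (i : ℕ) (it : Item P T)
      (hpc : (s.loc p).pc = .popFetch) (ha : s.array (s.loc p).head = some i)
      (hi : s.heap i = some it) (hp : it.place = p) :
      Step prio kmax s p .internal
        (s.setLoc p ⟨(s.loc p).head + 1, (s.loc p).queue, .popScan⟩)
  | popSelect (s : State P T) (p : P) (r : ItemRef) (q : Multiset ItemRef) (it : Item P T)
      (hpc : (s.loc p).pc = .popSelect) (hq : (s.loc p).queue = r ::ₘ q)
      (hi : s.heap r.it = some it)
      (hmax : ∀ r' ∈ q, ∀ it', s.heap r'.it = some it' → prio it'.task ≤ prio it.task) :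
      Step prio kmax s p .internal (s.setLoc p ⟨(s.loc p).head, q, .popCas r it.task⟩)
  | popCasOk (s : State P T) (p : P) (r : ItemRef) (a : T) (it : Item P T)
      (hpc : (s.loc p).pc = .popCas r a) (hi : s.heap r.it = some it)
      (htag : it.tag = (r.tag : ℤ)) :
      Step prio kmax s p .internal
        ((s.setItem r.it { it with tag := -1 }).setPc p (.popReturn (.fromQueue r.it a)))
  | popCasFail (s : State P T) (p : P) (r : ItemRef) (a : T) (it : Item P T)
      (hpc : (s.loc p).pc = .popCas r a) (hi : s.heap r.it = some it)
      (htag : it.tag ≠ (r.tag : ℤ)) :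
      Step prio kmax s p .internal (s.setPc p .popScan)
  | popEmpty (s : State P T) (p : P) (off : ℕ)
      (hpc : (s.loc p).pc = .popSelect) (hq : (s.loc p).queue = 0) (hoff : off < kmax) :
      Step prio kmax s p .internal (s.setPc p (.popProbe off))
  /- After the scan `head` is the value of `tail` that this `pop` has observed last. -/
  | popProbeHit (s : State P T) (p : P) (off i : ℕ) (it : Item P T)
      (hpc : (s.loc p).pc = .popProbe off) (ha : s.array ((s.loc p).head + off) = some i)
      (hi : s.heap i = some it) (hk : off < it.k) :
      Step prio kmax s p .internal
        (s.setPc p (.popProbeCas ((s.loc p).head + off) i it.task))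
  | popProbeFar (s : State P T) (p : P) (off i : ℕ) (it : Item P T)
      (hpc : (s.loc p).pc = .popProbe off) (ha : s.array ((s.loc p).head + off) = some i)
      (hi : s.heap i = some it) (hk : it.k ≤ off) :
      Step prio kmax s p .internal (s.setPc p (.popReturn .empty))
  | popProbeNull (s : State P T) (p : P) (off : ℕ)
      (hpc : (s.loc p).pc = .popProbe off) (ha : s.array ((s.loc p).head + off) = none) :
      Step prio kmax s p .internal (s.setPc p (.popReturn .empty))
  | popProbeCasOk (s : State P T) (p : P) (pos i : ℕ) (a : T) (it : Item P T)
      (hpc : (s.loc p).pc = .popProbeCas pos i a) (hi : s.heap i = some it)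
      (htag : it.tag = (pos : ℤ)) :
      Step prio kmax s p .internal
        ((s.setItem i { it with tag := -1 }).setPc p (.popReturn (.fromProbe i a)))
  | popProbeCasFail (s : State P T) (p : P) (pos i : ℕ) (a : T) (it : Item P T)
      (hpc : (s.loc p).pc = .popProbeCas pos i a) (hi : s.heap i = some it)
      (htag : it.tag ≠ (pos : ℤ)) :
      Step prio kmax s p .internal (s.setPc p (.popReturn .empty))
  | popReturn (s : State P T) (p : P) (o : Outcome T)
      (hpc : (s.loc p).pc = .popReturn o) :
      Step prio kmax s p (.retPop o) (s.setPc p .idle)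

/-- A finite execution with `n` steps: step `i` leads from `σ i` to `σ (i + 1)` and is made by the
place `(lab i).1` with label `(lab i).2`. Places interleave arbitrarily. -/
def IsRun {P T Q : Type*} [DecidableEq P] [LinearOrder Q] (prio : T → Q) (kmax n : ℕ)
    (σ : ℕ → State P T) (lab : ℕ → P × Act T) : Prop :=
  σ 0 = State.init P T ∧ ∀ i < n, Step prio kmax (σ i) (lab i).1 (lab i).2 (σ (i + 1))

/-- An infinite execution. -/
def IsInfRun {P T Q : Type*} [DecidableEq P] [LinearOrder Q] (prio : T → Q) (kmax : ℕ)
    (σ : ℕ → State P T) (lab : ℕ → P × Act T) : Prop :=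
  ∀ n, IsRun prio kmax n σ lab

/-- Lock-freedom of `pop`. -/
structure PopLockFree {P T Q : Type*} [DecidableEq P] [LinearOrder Q] (prio : T → Q)
    (kmax : ℕ) : Prop where
  /-- A pending `pop` is never blocked: its place always has a next step. -/
  enabled : ∀ (n : ℕ) (σ : ℕ → State P T) (lab : ℕ → P × Act T), IsRun prio kmax n σ lab →
    ∀ p : P, ((σ n).loc p).pc.IsPop → ∃ act s', Step prio kmax (σ n) p act s'
  /-- If infinitely many steps of `pop` operations are made, infinitely many operations complete. -/
  system : ∀ (σ : ℕ → State P T) (lab : ℕ → P × Act T), IsInfRun prio kmax σ lab →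
    (∃ᶠ i in atTop, ((σ i).loc (lab i).1).pc.IsPop) → ∃ᶠ i in atTop, (lab i).2.IsRet
  /-- If one `pop` makes infinitely many steps without returning, then the other places complete
  infinitely many operations successfully. -/
  individual : ∀ (σ : ℕ → State P T) (lab : ℕ → P × Act T), IsInfRun prio kmax σ lab →
    ∀ (p : P) (m : ℕ), (∀ i ≥ m, ((σ i).loc p).pc.IsPop) → (∃ᶠ i in atTop, (lab i).1 = p) →
      ∃ᶠ i in atTop, (lab i).1 ≠ p ∧ (lab i).2.IsSuccess

/-- Operations of the sequential object; an element of the object is a task together with the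
address of the item that holds it (so that equal tasks pushed twice are told apart). -/
inductive Op (T : Type*) where
  | push (x : ℕ × T) : Op T
  | pop (o : Outcome T) : Op T

/-- The element a `pop` returns, if any. -/
def Outcome.item? {T : Type*} : Outcome T → Option (ℕ × T)
  | .empty => none
  | .fromQueue i a => some (i, a)
  | .fromProbe i a => some (i, a)

/-- Effect of an operation on the set of stored elements. -/
def Op.apply {T : Type*} (S : Set (ℕ × T)) : Op T → Set (ℕ × T)
  | .push x => insert x S
  | .pop o => {y ∈ S | o.item? ≠ some y}

/-- The elements stored after a sequence of operations on the empty object. -/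
def contents {T : Type*} (L : List (Op T)) : Set (ℕ × T) :=
  L.foldl Op.apply ∅

/-- The element an operation adds, if any. -/
def Op.pushed? {T : Type*} : Op T → Option (ℕ × T)
  | .push x => some x
  | .pop _ => none

/-- The elements pushed by a sequence of operations, oldest first. -/
def pushed {T : Type*} (L : List (Op T)) : List (ℕ × T) :=
  L.filterMap Op.pushed?

/-- The sequential specification without ordering guarantees: each `push` adds a new element, and
a successful `pop` removes and returns a stored one. -/
def Legal {T : Type*} (L : List (Op T)) : Prop :=
  ∀ (L₁ : List (Op T)) (op : Op T) (L₂ : List (Op T)), L = L₁ ++ op :: L₂ →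
    match op with
    | .push x => x ∉ pushed L₁
    | .pop o => ∀ x, o.item? = some x → x ∈ contents L₁

/-- The elements ignored by a `pop` with outcome `o` that takes effect after the operations `L`:
those stored with a priority higher than that of the returned task; if nothing is returned, all
stored elements. -/
def ignored {T Q : Type*} [LinearOrder Q] (prio : T → Q) (L : List (Op T)) (o : Outcome T) :
    Set (ℕ × T) :=
  {y ∈ contents L | ∀ x, o.item? = some x → prio x.2 < prio y.2}

/-- Step `m` is the response to the operation invoked by step `j`. -/
def Responds {P T : Type*} (lab : ℕ → P × Act T) (j m : ℕ) : Prop :=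
  j < m ∧ (lab m).1 = (lab j).1 ∧ (lab m).2.IsRet ∧
    ∀ l, j < l → l < m → (lab l).1 = (lab j).1 → ¬ (lab l).2.IsRet

/-- An entry of a linearization: the step `inv` that invokes the operation, the operation with its
result, and the linearization point `pt` (the operation takes effect in the state `σ pt`). -/
structure Entry (T : Type*) where
  inv : ℕ
  op : Op T
  pt : ℕ

/-- The operation of the entry is the one invoked by the step `inv`. -/
def Entry.Matches {P T : Type*} (lab : ℕ → P × Act T) (e : Entry T) : Prop :=
  match e.op with
  | .push x => ∃ k, (lab e.inv).2 = .invPush k x.2 x.1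
  | .pop _ => (lab e.inv).2 = .invPop

/-- `L` linearizes the execution with `n` steps: the operations of `L`, in this order, are legal
for the sequential object; every completed operation occurs exactly once, with its actual result;
pending operations occur at most once; and every operation takes effect between its invocation and
its response. In particular operations that do not overlap keep their order. -/
structure IsLinearization {P T : Type*} (n : ℕ) (lab : ℕ → P × Act T) (L : List (Entry T)) :
    Prop where
  legal : Legal (L.map Entry.op)
  sorted : L.Pairwise (fun e e' => e.pt ≤ e'.pt)
  nodup : (L.map Entry.inv).Nodup
  invoked : ∀ e ∈ L, e.inv < e.pt ∧ e.pt ≤ n ∧ e.Matches lab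
  responded : ∀ e ∈ L, ∀ m < n, Responds lab e.inv m →
    e.pt ≤ m + 1 ∧ ∀ o, e.op = .pop o → (lab m).2 = .retPop o
  complete : ∀ j m, m < n → Responds lab j m →
    ((lab j).2 = .invPop ∨ ∃ k a i, (lab j).2 = .invPush k a i) → ∃ e ∈ L, e.inv = j

/-- The elements of `Y` are at most `k` many, and in the state `s` each of them is stored after
`tail`, in one of the `k` array positions from `tail` on. -/
def AfterTail {P T : Type*} (s : State P T) (k : ℕ) (Y : Set (ℕ × T)) : Prop :=
  Y.encard ≤ k ∧ ∀ y ∈ Y, ∃ pos, s.tail ≤ pos ∧ pos < s.tail + k ∧ s.array pos = some y.1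

/-- All `push` operations invoked in the first `n` steps use the parameter `k`. -/
def UniformK {P T : Type*} (n : ℕ) (lab : ℕ → P × Act T) (k : ℕ) : Prop :=
  ∀ j < n, ∀ k' a i, (lab j).2 = .invPush k' a i → k' = k

/-- The outcome is not a task found by the random probe behind `tail`. -/
def Outcome.NotProbe {T : Type*} : Outcome T → Prop
  | .fromProbe _ _ => False
  | _ => True

end CentralK

/-! Everything rests on one invariant of the reachable states, `State.WF`. Its main clauses: all
positions before `tail` are occupied, because `tail` passes a block only after a `push` has found
each of its positions occupied; an item with parameter k lies before `tail + k`; and every untaken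
item that a place has passed with its head or has created and inserted itself is in its queue, or in
transit between its program counter and its queue.

Lock-freedom: while `tail` is bounded, the steps of a single `pop` decrease a natural number
(`Step.weight_lt`). If no `push` returns any more, every newly filled position belongs to a place
that is still about to return from its `push`; there are finitely many places, so `tail` is bounded
(`IsInfRun.tail_le`). Hence a `pop` that runs forever is overtaken by infinitely many completed
`push` operations.

Linearizability: a `push` takes effect when its item enters the array. A `pop` takes effect at the
end of its last scan, when its queue contains every untaken item before `tail`; only if it returns a
probed item that was inserted after this scan does it take effect later, right after that insertion.
In every case this is no later than the CAS that takes the item. So whatever the sequential object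
stores is really untaken in the state at the linearization point (`IsRun.array_of_mem_contents`). An
ignored item cannot lie before the `tail` of the scan: it would have been in the queue, which would
then be nonempty and would yield a task of at least its priority. By the invariant it lies fewer
than k positions after `tail` (`IsRun.tail_le_of_mem_ignored`).

This requires that `tail` be the same at the scan and at the linearization point. For tasks from the
queue and for null the two points coincide. With a uniform k, `tail` is always a multiple of k, and
a late probed item lies fewer than k positions after the old `tail`, so `tail` has not moved when it
is inserted (`PopData.tail_eq`). By the same divisibility, all items pushed since an ignored one
share its block of k positions, so they are at most k (`IsRun.mem_rtake_pushed`). -/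

namespace CentralK

/-! ### The invariant of the reachable states and its preservation -/

/-- The item that a place is about to insert into the array. -/
def PC.inserting? {T : Type*} : PC T → Option ℕ
  | .pushRead i | .pushTag i _ _ _ | .pushCas i _ _ _ | .pushTail i _ => some i
  | _ => none

/-- The invariant of the reachable states. -/
structure State.WF {P T : Type*} (kmax : ℕ) (s : State P T) : Prop where
  head_le : ∀ p, (s.loc p).head ≤ s.tail
  param : ∀ i it, s.heap i = some it → 1 ≤ it.k ∧ it.k ≤ kmax
  item : ∀ pos i, s.array pos = some i → ∃ it, s.heap i = some it ∧
    (it.tag = (pos : ℤ) ∨ it.tag = -1) ∧ pos < s.tail + it.k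
  inj : ∀ pos pos' i, s.array pos = some i → s.array pos' = some i → pos = pos'
  full : ∀ pos < s.tail, s.array pos ≠ none
  inserting : ∀ p i, (s.loc p).pc.inserting? = some i →
    (∃ it, s.heap i = some it ∧ it.place = p) ∧ ∀ pos, s.array pos ≠ some i
  pushTag : ∀ p i t off j it, (s.loc p).pc = .pushTag i t off j → s.heap i = some it →
    t ≤ s.tail ∧ off < it.k ∧ j < it.k ∧ ∀ j' < j, s.array (t + (off + j') % it.k) ≠ none
  pushCas : ∀ p i t off j it, (s.loc p).pc = .pushCas i t off j → s.heap i = some it →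
    t ≤ s.tail ∧ off < it.k ∧ j < it.k ∧ (∀ j' < j, s.array (t + (off + j') % it.k) ≠ none) ∧
      it.tag = ((t + (off + j) % it.k : ℕ) : ℤ)
  pushTail : ∀ p i t it, (s.loc p).pc = .pushTail i t → s.heap i = some it →
    ∀ m < it.k, s.array (t + m) ≠ none
  pushRef : ∀ p i pos, (s.loc p).pc = .pushRef i pos →
    s.array pos = some i ∧ ∃ it, s.heap i = some it ∧ it.place = p
  popFetch : ∀ p, (s.loc p).pc = .popFetch → (s.loc p).head < s.tail
  popCas : ∀ p r a, (s.loc p).pc = .popCas r a →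
    s.array r.tag = some r.it ∧ ∃ it, s.heap r.it = some it ∧ it.task = a
  popProbeCas : ∀ p pos i a, (s.loc p).pc = .popProbeCas pos i a →
    s.array pos = some i ∧ ∃ it, s.heap i = some it ∧ it.task = a
  queue : ∀ p, ∀ r ∈ (s.loc p).queue, s.array r.tag = some r.it
  cover : ∀ p pos i it, s.array pos = some i → s.heap i = some it → it.tag = (pos : ℤ) →
    (pos < (s.loc p).head ∨ it.place = p) →
    ⟨pos, i⟩ ∈ (s.loc p).queue ∨ (s.loc p).pc = .pushRef i pos ∨
      ∃ a, (s.loc p).pc = .popCas ⟨pos, i⟩ a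

theorem State.WF.init {P T : Type*} (kmax : ℕ) : (State.init P T).WF kmax := by
  constructor <;> simp [State.init, PC.inserting?]

/-- The offsets probed by a `push` run through all residues. -/
theorem exists_lt_add_mod_eq {k off m : ℕ} (hoff : off < k) (hm : m < k) :
    ∃ j < k, (off + j) % k = m := by
  by_cases h : off ≤ m
  · exact ⟨m - off, by omega, by rw [Nat.add_sub_cancel' h, Nat.mod_eq_of_lt hm]⟩
  · refine ⟨m + k - off, by omega, ?_⟩
    rw [show off + (m + k - off) = m + k by omega, Nat.add_mod_right, Nat.mod_eq_of_lt hm]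

section
variable {P T Q : Type*} [DecidableEq P] [LinearOrder Q] {prio : T → Q} {kmax : ℕ}
  {s s' : State P T} {p : P} {act : Act T}

theorem Step.loc_eq (h : Step prio kmax s p act s') {q : P} (hq : q ≠ p) :
    s'.loc q = s.loc q := by
  cases h <;> simp [State.setPc, State.setLoc, State.setItem, hq]

theorem Step.tail_le (h : Step prio kmax s p act s') : s.tail ≤ s'.tail := by
  cases h <;> simp [State.setPc, State.setLoc, State.setItem]
  omega

theorem Step.array_eq (h : Step prio kmax s p act s') {pos i : ℕ} (ha : s.array pos = some i) :
    s'.array pos = some i := by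
  cases h <;> simp [State.setPc, State.setLoc, State.setItem, ha, Function.update_apply]
  grind

theorem Step.heap_eq (h : Step prio kmax s p act s') {i : ℕ} {it : Item P T}
    (ha : s.heap i = some it) :
    ∃ it', s'.heap i = some it' ∧ it'.place = it.place ∧ it'.k = it.k ∧ it'.task = it.task := by
  cases h <;> simp [State.setPc, State.setLoc, State.setItem, ha, Function.update_apply] <;> grind

/-- An item that is being inserted is changed by its creator only. -/
theorem Step.heap_inserting (h : Step prio kmax s p act s') (w : s.WF kmax) {q : P} (hq : q ≠ p)
    {i : ℕ} (hi : (s.loc q).pc.inserting? = some i) : s'.heap i = s.heap i := by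
  obtain ⟨⟨it, h1, h2⟩, h3⟩ := w.inserting q i hi
  -- A `push` of `p` writes to a fresh address or to an item created by `p`, and a `pop` writes only
  -- to items that are in the array; neither can be the item that `q` is inserting.
  have h4 := w.inserting p
  have h5 := w.popCas p
  have h6 := w.popProbeCas p
  cases h <;> simp only [State.setPc, State.setLoc, State.setItem, Function.update_apply] <;>
    simp_all only [PC.inserting?] <;> grind

theorem Step.array_ne_none (h : Step prio kmax s p act s') {pos : ℕ} (ha : s.array pos ≠ none) :
    s'.array pos ≠ none := by
  obtain ⟨i, hi⟩ := Option.ne_none_iff_exists'.1 ha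
  simp [h.array_eq hi]

/-- Only an item that is not yet in the array gets a new position as its tag; once it is stored, the
tag can only become -1. A new entry lies below `t + k`, where `t` is an earlier value of `tail` and
hence at most the present one. -/
theorem Step.wf_item (h : Step prio kmax s p act s') (w : s.WF kmax) :
    ∀ pos i, s'.array pos = some i → ∃ it, s'.heap i = some it ∧
    (it.tag = (pos : ℤ) ∨ it.tag = -1) ∧ pos < s'.tail + it.k := by
  have h1 := w.item
  have ht := h.tail_le
  intro pos i hp
  by_cases ha : s.array pos = some i
  · obtain ⟨it, h2, h3, h4⟩ := h1 pos i ha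
    have h4 := w.inserting p
    have h5 := w.popCas p
    have h6 := w.popProbeCas p
    cases h
    case pushTag =>
      simp_all only [PC.inserting?]
      simp only [State.setPc, State.setLoc, State.setItem, Function.update_apply]
      grind
    all_goals
      simp only [State.setPc, State.setLoc, State.setItem, Function.update_apply] at hp ht ⊢
      grind
  · cases h
    case pushCasOk i t off j it hpc hi hnull =>
      have h2 := w.pushCas p _ _ _ _ _ hpc hi
      have h3 := Nat.mod_lt (off + j) (show 0 < it.k by omega)
      simp only [State.setPc, State.setLoc, State.setItem, Function.update_apply] at hp ht ⊢
      grind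
    all_goals
      simp only [State.setPc, State.setLoc, State.setItem] at hp
      exact absurd hp ha

theorem Step.wf_full (h : Step prio kmax s p act s') (w : s.WF kmax) :
    ∀ pos < s'.tail, s'.array pos ≠ none := by
  intro pos hp
  by_cases hs : pos < s.tail
  · exact h.array_ne_none (w.full pos hs)
  · cases h
    case pushTailOk i t it hpc hi ht =>
      simp only [State.setPc, State.setLoc] at hp ⊢
      have := w.pushTail p i t it hpc hi (pos - t) (by omega)
      rwa [Nat.add_sub_cancel' (by omega)] at this
    all_goals
      simp only [State.setPc, State.setLoc, State.setItem] at hp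
      exact absurd hp hs

theorem Step.wf_inserting (h : Step prio kmax s p act s') (w : s.WF kmax) :
    ∀ p i, (s'.loc p).pc.inserting? = some i →
    (∃ it, s'.heap i = some it ∧ it.place = p) ∧ ∀ pos, s'.array pos ≠ some i := by
  intro q i hi
  by_cases hq : q = p
  · subst hq
    have h1 := w.inserting q
    have h2 := w.item
    cases h
    case pushInvoke k a i' hpc hk hk' hi' =>
      simp only [State.setPc, State.setLoc, State.setItem, Function.update_self,
        PC.inserting?, Option.some.injEq] at hi ⊢
      subst hi
      refine ⟨⟨_, Function.update_self .., rfl⟩, fun pos hp => ?_⟩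
      obtain ⟨it, h3, -⟩ := h2 pos _ hp
      simp [hi'] at h3
    all_goals simp only [State.setPc, State.setLoc, State.setItem, Function.update_self,
      PC.inserting?, Function.update_apply] at hi ⊢ <;> simp_all only [PC.inserting?] <;> grind
  · rw [h.loc_eq hq] at hi
    rw [h.heap_inserting w hq hi]
    refine ⟨(w.inserting q i hi).1, fun pos hp => ?_⟩
    have h3 := (w.inserting q i hi).2 pos
    have h4 := w.inserting p
    obtain ⟨it, h5, h6⟩ := (w.inserting q i hi).1
    cases h <;> simp only [State.setPc, State.setLoc, State.setItem, Function.update_apply] at hp <;>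
      simp_all only [PC.inserting?] <;> grind

theorem Step.wf_pushTag (h : Step prio kmax s p act s') (w : s.WF kmax) :
    ∀ p i t off j it, (s'.loc p).pc = .pushTag i t off j → s'.heap i = some it →
    t ≤ s'.tail ∧ off < it.k ∧ j < it.k ∧ ∀ j' < j, s'.array (t + (off + j') % it.k) ≠ none := by
  intro q i t off j it hpc hi
  by_cases hq : q = p
  · subst hq
    cases h <;> simp only [State.setPc, State.setLoc, State.setItem, Function.update_self,
      reduceCtorEq, PC.pushTag.injEq] at hpc hi ⊢
    case pushRead => grind
    case pushCasNext i t off j it' hpc' hi' hfull hj =>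
      obtain ⟨rfl, rfl, rfl, rfl⟩ := hpc
      obtain rfl : it = it' := by grind
      have := w.pushCas _ _ _ _ _ _ hpc' hi
      refine ⟨this.1, this.2.1, hj, fun j' hj' => ?_⟩
      rcases Nat.lt_succ_iff_lt_or_eq.1 hj' with h | rfl
      · exact this.2.2.2.1 _ h
      · exact hfull
  · rw [h.loc_eq hq] at hpc
    rw [h.heap_inserting w hq (by rw [hpc]; rfl)] at hi
    have := w.pushTag _ _ _ _ _ _ hpc hi
    exact ⟨this.1.trans h.tail_le, this.2.1, this.2.2.1,
      fun j' hj' => h.array_ne_none (this.2.2.2 j' hj')⟩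

theorem Step.wf_pushCas (h : Step prio kmax s p act s') (w : s.WF kmax) :
    ∀ p i t off j it, (s'.loc p).pc = .pushCas i t off j → s'.heap i = some it →
    t ≤ s'.tail ∧ off < it.k ∧ j < it.k ∧ (∀ j' < j, s'.array (t + (off + j') % it.k) ≠ none) ∧
      it.tag = ((t + (off + j) % it.k : ℕ) : ℤ) := by
  intro q i t off j it hpc hi
  by_cases hq : q = p
  · subst hq
    cases h <;> simp only [State.setPc, State.setLoc, State.setItem, Function.update_self,
      reduceCtorEq, PC.pushCas.injEq] at hpc hi ⊢
    case pushTag i t off j it' hpc' hi' =>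
      obtain ⟨rfl, rfl, rfl, rfl⟩ := hpc
      rw [Function.update_self, Option.some.injEq] at hi
      subst hi
      have := w.pushTag _ _ _ _ _ _ hpc' hi'
      exact ⟨this.1, this.2.1, this.2.2.1, this.2.2.2, rfl⟩
  · rw [h.loc_eq hq] at hpc
    rw [h.heap_inserting w hq (by rw [hpc]; rfl)] at hi
    have := w.pushCas _ _ _ _ _ _ hpc hi
    exact ⟨this.1.trans h.tail_le, this.2.1, this.2.2.1,
      fun j' hj' => h.array_ne_none (this.2.2.2.1 j' hj'), this.2.2.2.2⟩

theorem Step.wf_pushTail (h : Step prio kmax s p act s') (w : s.WF kmax) :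
    ∀ p i t it, (s'.loc p).pc = .pushTail i t → s'.heap i = some it →
    ∀ m < it.k, s'.array (t + m) ≠ none := by
  intro q i t it hpc hi m hm
  by_cases hq : q = p
  · subst hq
    cases h <;> simp only [State.setPc, State.setLoc, State.setItem, Function.update_self,
      reduceCtorEq, PC.pushTail.injEq] at hpc hi ⊢
    case pushCasLast i t off j it' hpc' hi' hfull hj =>
      obtain ⟨rfl, rfl⟩ := hpc
      obtain rfl : it = it' := by grind
      have := w.pushCas _ _ _ _ _ _ hpc' hi
      -- The k probes visit every residue, so the position `t + m` was found occupied by an earlier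
      -- probe or by the present one.
      obtain ⟨j', hj', rfl⟩ := exists_lt_add_mod_eq this.2.1 hm
      rcases Nat.lt_or_ge j' j with h | h
      · exact this.2.2.2.1 _ h
      · obtain rfl : j' = j := by omega
        exact hfull
  · rw [h.loc_eq hq] at hpc
    rw [h.heap_inserting w hq (by rw [hpc]; rfl)] at hi
    exact h.array_ne_none (w.pushTail _ _ _ _ hpc hi m hm)

/-- References only change hands: returning from `push` moves one from the program counter to the
queue, selecting moves one back, and a CAS discards it only when the tag differs from the position
or becomes -1. A new entry is not below any head, since the positions before `tail` are full, so it
concerns only its creator, which is then at `pushRef`. This is also why a place may skip its own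
items when it scans. -/
theorem Step.wf_cover (h : Step prio kmax s p act s') (w : s.WF kmax) :
    ∀ p pos i it, s'.array pos = some i → s'.heap i = some it → it.tag = (pos : ℤ) →
    (pos < (s'.loc p).head ∨ it.place = p) →
    ⟨pos, i⟩ ∈ (s'.loc p).queue ∨ (s'.loc p).pc = .pushRef i pos ∨
      ∃ a, (s'.loc p).pc = .popCas ⟨pos, i⟩ a := by
  obtain ⟨w1, -, -, -, w5, w6, -, -, -, w10, -, -, -, -, w15⟩ := w
  intro q
  by_cases hq : q = p
  · subst hq
    cases h
    case popSelect r c it hpc hq hi hmax =>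
      simp only [State.setLoc, Function.update_self, PC.popCas.injEq]
      intro pos i it' h1 h2 h3 h4
      have h5 := w15 q pos i it' h1 h2 h3 h4
      simp only [hpc, hq, Multiset.mem_cons, reduceCtorEq, exists_false, or_false] at h5
      rcases h5 with rfl | h5
      · exact .inr (.inr ⟨_, rfl, rfl⟩)
      · exact .inl h5
    all_goals
      simp only [State.setPc, State.setLoc, State.setItem, Function.update_self]
      grind [Function.update_apply, PC.inserting?]
  · cases h <;> simp only [State.setPc, State.setLoc, State.setItem, Function.update_of_ne hq] <;>
      grind [Function.update_apply, PC.inserting?]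

theorem Step.wf_head_le (h : Step prio kmax s p act s') (w : s.WF kmax) :
    ∀ p, (s'.loc p).head ≤ s'.tail := by
  have h1 := w.head_le
  have h2 := w.popFetch
  clear w
  intro q
  by_cases hq : q = p
  · subst hq
    cases h <;> simp only [State.setPc, State.setLoc, State.setItem, Function.update_self] <;>
      grind [Function.update_apply, PC.inserting?]
  · cases h <;> simp only [State.setPc, State.setLoc, State.setItem, Function.update_of_ne hq] <;>
      grind [Function.update_apply, PC.inserting?]

theorem Step.wf_param (h : Step prio kmax s p act s') (w : s.WF kmax) :
    ∀ i it, s'.heap i = some it → 1 ≤ it.k ∧ it.k ≤ kmax := by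
  have h1 := w.param
  cases h <;> simp only [State.setPc, State.setLoc, State.setItem] <;>
    grind [Function.update_apply, PC.inserting?]

theorem Step.wf_inj (h : Step prio kmax s p act s') (w : s.WF kmax) :
    ∀ pos pos' i, s'.array pos = some i → s'.array pos' = some i → pos = pos' := by
  have h1 := w.inj
  have h2 := w.inserting
  cases h <;> simp only [State.setPc, State.setLoc, State.setItem] <;>
    grind [Function.update_apply, PC.inserting?]

theorem Step.wf_pushRef (h : Step prio kmax s p act s') (w : s.WF kmax) :
    ∀ p i pos, (s'.loc p).pc = .pushRef i pos →
    s'.array pos = some i ∧ ∃ it, s'.heap i = some it ∧ it.place = p := by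
  have h1 := w.pushRef
  have h2 := w.inserting
  clear w
  intro q
  by_cases hq : q = p
  · subst hq
    cases h <;> simp only [State.setPc, State.setLoc, State.setItem, Function.update_self] <;>
      grind [Function.update_apply, PC.inserting?]
  · cases h <;> simp only [State.setPc, State.setLoc, State.setItem, Function.update_of_ne hq] <;>
      grind [Function.update_apply, PC.inserting?]

theorem Step.wf_popFetch (h : Step prio kmax s p act s') (w : s.WF kmax) :
    ∀ p, (s'.loc p).pc = .popFetch → (s'.loc p).head < s'.tail := by
  have h1 := w.popFetch
  clear w
  intro q
  by_cases hq : q = p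
  · subst hq
    cases h <;> simp only [State.setPc, State.setLoc, State.setItem, Function.update_self] <;>
      grind [Function.update_apply, PC.inserting?]
  · cases h <;> simp only [State.setPc, State.setLoc, State.setItem, Function.update_of_ne hq] <;>
      grind [Function.update_apply, PC.inserting?]

theorem Step.wf_popCas (h : Step prio kmax s p act s') (w : s.WF kmax) :
    ∀ p r a, (s'.loc p).pc = .popCas r a →
    s'.array r.tag = some r.it ∧ ∃ it, s'.heap r.it = some it ∧ it.task = a := by
  have h1 := w.popCas
  have h2 := w.queue
  clear w
  intro q
  by_cases hq : q = p
  · subst hq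
    cases h <;> simp only [State.setPc, State.setLoc, State.setItem, Function.update_self] <;>
      grind [Function.update_apply, PC.inserting?]
  · cases h <;> simp only [State.setPc, State.setLoc, State.setItem, Function.update_of_ne hq] <;>
      grind [Function.update_apply, PC.inserting?]

theorem Step.wf_popProbeCas (h : Step prio kmax s p act s') (w : s.WF kmax) :
    ∀ p pos i a, (s'.loc p).pc = .popProbeCas pos i a →
    s'.array pos = some i ∧ ∃ it, s'.heap i = some it ∧ it.task = a := by
  have h1 := w.popProbeCas
  clear w
  intro q
  by_cases hq : q = p
  · subst hq
    cases h <;> simp only [State.setPc, State.setLoc, State.setItem, Function.update_self] <;>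
      grind [Function.update_apply, PC.inserting?]
  · cases h <;> simp only [State.setPc, State.setLoc, State.setItem, Function.update_of_ne hq] <;>
      grind [Function.update_apply, PC.inserting?]

theorem Step.wf_queue (h : Step prio kmax s p act s') (w : s.WF kmax) :
    ∀ p, ∀ r ∈ (s'.loc p).queue, s'.array r.tag = some r.it := by
  have h1 := w.queue
  have h2 := w.pushRef
  clear w
  intro q
  by_cases hq : q = p
  · subst hq
    cases h <;> simp only [State.setPc, State.setLoc, State.setItem, Function.update_self] <;>
      grind [Function.update_apply, PC.inserting?]
  · cases h <;> simp only [State.setPc, State.setLoc, State.setItem, Function.update_of_ne hq] <;>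
      grind [Function.update_apply, PC.inserting?]

theorem Step.wf (h : Step prio kmax s p act s') (w : s.WF kmax) : s'.WF kmax :=
  ⟨h.wf_head_le w, h.wf_param w, h.wf_item w, h.wf_inj w, h.wf_full w, h.wf_inserting w,
    h.wf_pushTag w, h.wf_pushCas w, h.wf_pushTail w, h.wf_pushRef w, h.wf_popFetch w,
    h.wf_popCas w, h.wf_popProbeCas w, h.wf_queue w, h.wf_cover w⟩

end

/-! ### Lock-freedom -/

section
variable {P T Q : Type*} [DecidableEq P] [LinearOrder Q] {prio : T → Q} {kmax : ℕ}
  {s s' : State P T} {p : P} {act : Act T}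

theorem State.WF.exists_popSelect (w : s.WF kmax) (hpc : (s.loc p).pc = .popSelect)
    (hq : (s.loc p).queue ≠ 0) : ∃ act s', Step prio kmax s p act s' := by
  classical
  -- The value ⊥ for an unallocated address makes the priority a total function, which can be
  -- maximized over the queue.
  let g : ItemRef → WithBot Q := fun r => (s.heap r.it).elim ⊥ fun it => (prio it.task : WithBot Q)
  obtain ⟨r₀, hr₀⟩ := Multiset.exists_mem_of_ne_zero hq
  obtain ⟨r, hr, hmax⟩ := (s.loc p).queue.toFinset.exists_max_image g
    ⟨r₀, Multiset.mem_toFinset.2 hr₀⟩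
  rw [Multiset.mem_toFinset] at hr
  obtain ⟨it, hit, -⟩ := w.item _ _ (w.queue p r hr)
  obtain ⟨q, hq'⟩ := Multiset.exists_cons_of_mem hr
  refine ⟨_, _, .popSelect s p r q it hpc hq' hit fun r' hr' it' hit' => ?_⟩
  have := hmax r' (by simp [hq', hr'])
  simpa [g, hit, hit'] using this

theorem State.WF.exists_step (w : s.WF kmax) (hkmax : 1 ≤ kmax) (hp : (s.loc p).pc.IsPop) :
    ∃ act s', Step prio kmax s p act s' := by
  rcases hpc : (s.loc p).pc with _ | _ | _ | _ | _ | _ | _ | _ | _ | ⟨r, a⟩ | off | ⟨pos, i, a⟩ | o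
  case popScan =>
    by_cases h : (s.loc p).head < s.tail
    · exact ⟨_, _, .popScanMore s p hpc h⟩
    · exact ⟨_, _, .popScanDone s p hpc h⟩
  case popFetch =>
    obtain ⟨i, hi⟩ := Option.ne_none_iff_exists'.1 (w.full _ (w.popFetch p hpc))
    obtain ⟨it, hit, -⟩ := w.item _ _ hi
    by_cases h : it.place = p
    · exact ⟨_, _, .popFetchOwn s p i it hpc hi hit h⟩
    · exact ⟨_, _, .popFetchOther s p i it hpc hi hit h⟩
  case popSelect =>
    by_cases h : (s.loc p).queue = 0
    · exact ⟨_, _, .popEmpty s p 0 hpc h hkmax⟩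
    · exact w.exists_popSelect hpc h
  case popCas =>
    obtain ⟨-, it, hit, -⟩ := w.popCas p r a hpc
    by_cases h : it.tag = (r.tag : ℤ)
    · exact ⟨_, _, .popCasOk s p r a it hpc hit h⟩
    · exact ⟨_, _, .popCasFail s p r a it hpc hit h⟩
  case popProbe =>
    rcases ha : s.array ((s.loc p).head + off) with _ | i
    · exact ⟨_, _, .popProbeNull s p off hpc ha⟩
    · obtain ⟨it, hit, -⟩ := w.item _ _ ha
      by_cases h : off < it.k
      · exact ⟨_, _, .popProbeHit s p off i it hpc ha hit h⟩
      · exact ⟨_, _, .popProbeFar s p off i it hpc ha hit (not_lt.1 h)⟩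
  case popProbeCas =>
    obtain ⟨-, it, hit, -⟩ := w.popProbeCas p pos i a hpc
    by_cases h : it.tag = (pos : ℤ)
    · exact ⟨_, _, .popProbeCasOk s p pos i a it hpc hit h⟩
    · exact ⟨_, _, .popProbeCasFail s p pos i a it hpc hit h⟩
  case popReturn => exact ⟨_, _, .popReturn s p o hpc⟩
  all_goals simp [hpc, PC.IsPop] at hp

/-- The progress of a `pop` between two changes of its queue and its head. -/
def PC.rank {T : Type*} : PC T → ℕ
  | .popScan => 6
  | .popFetch => 5
  | .popSelect => 5
  | .popCas _ _ => 7
  | .popProbe _ => 4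
  | .popProbeCas _ _ _ => 3
  | _ => 0

/-- A bound for the number of steps that a `pop` can make while `tail` is at most `B`. -/
def Local.weight {T : Type*} (B : ℕ) (l : Local T) : ℕ :=
  10 * (2 * (B - l.head) + Multiset.card l.queue) + l.pc.rank

/-- A fetch lowers `B - head` by one and adds at most one reference, a net loss because of the
factor 2; a selection removes a reference. The factor 10 outweighs the rise of the rank in these
steps, and all other steps of a `pop` lower the rank. -/
theorem Step.weight_lt (h : Step prio kmax s p act s') (w : s.WF kmax)
    (hp : (s.loc p).pc.IsPop) (hp' : (s'.loc p).pc.IsPop) {B : ℕ} (hB : s.tail ≤ B) :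
    (s'.loc p).weight B < (s.loc p).weight B := by
  have hf := w.popFetch p
  cases h <;> simp_all only [PC.IsPop, State.setPc, State.setLoc, State.setItem,
    Function.update_self, Local.weight, PC.rank, Multiset.card_cons, forall_true_left] <;> omega

theorem Step.isPop (h : Step prio kmax s p act s') {q : P} (hq : (s.loc q).pc.IsPop)
    (hact : ¬ act.IsRet) : (s'.loc q).pc.IsPop := by
  by_cases hqp : q = p
  · subst hqp
    cases h <;> simp_all [PC.IsPop, State.setPc, State.setLoc, State.setItem, Act.IsRet]
  · rwa [h.loc_eq hqp]

theorem Step.array_ne_none_cases (h : Step prio kmax s p act s') {pos : ℕ}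
    (ha : s'.array pos ≠ none) : s.array pos ≠ none ∨ ∃ i, (s'.loc p).pc = .pushRef i pos := by
  cases h
  case pushCasOk i t off j it hpc hi hnull =>
    simp only [State.setPc, State.setLoc, Function.update_apply] at ha ⊢
    split at ha <;> simp_all
  all_goals exact .inl ha

theorem Step.pc_of_retPush (h : Step prio kmax s p .retPush s') :
    ∃ i pos, (s.loc p).pc = .pushRef i pos := by
  generalize hact : Act.retPush = act at h
  cases h <;> simp_all

theorem Step.pushRef_of_not_retPush (h : Step prio kmax s p act s') {q : P} {i pos : ℕ}
    (hq : (s.loc q).pc = .pushRef i pos) (hact : ¬ (act = .retPush ∧ p = q)) :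
    (s'.loc q).pc = .pushRef i pos := by
  by_cases hqp : q = p
  · subst hqp
    cases h <;> simp_all
  · rwa [h.loc_eq hqp]

variable {σ : ℕ → State P T} {lab : ℕ → P × Act T} {n : ℕ}

theorem IsRun.wf (h : IsRun prio kmax n σ lab) {t : ℕ} (ht : t ≤ n) : (σ t).WF kmax := by
  induction t with
  | zero => rw [h.1]; exact .init kmax
  | succ t ih => exact (h.2 t ht).wf (ih (by omega))

theorem IsInfRun.step (h : IsInfRun prio kmax σ lab) (t : ℕ) :
    Step prio kmax (σ t) (lab t).1 (lab t).2 (σ (t + 1)) := (h (t + 1)).2 t (by omega)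

theorem IsInfRun.wf (h : IsInfRun prio kmax σ lab) (t : ℕ) : (σ t).WF kmax := (h t).wf le_rfl

/-- Without successful completions, `tail` stays bounded. -/
theorem IsInfRun.tail_le [Fintype P] (h : IsInfRun prio kmax σ lab) {N : ℕ}
    (hN : ∀ i ≥ N, (lab i).2 ≠ .retPush) {t : ℕ} (ht : N ≤ t) :
    (σ t).tail ≤ (σ N).tail + kmax + Fintype.card P := by
  classical
  have key : ∀ pos, (σ t).array pos ≠ none →
      (σ N).array pos ≠ none ∨ ∃ q i, ((σ t).loc q).pc = .pushRef i pos := by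
    induction t, ht using Nat.le_induction with
    | base => exact fun pos hp => .inl hp
    | succ t ht ih =>
      intro pos hp
      rcases (h.step t).array_ne_none_cases hp with hp | ⟨i, hi⟩
      · refine (ih pos hp).imp_right ?_
        rintro ⟨q, i, hi⟩
        exact ⟨q, i, (h.step t).pushRef_of_not_retPush hi fun hc => hN t ht hc.1⟩
      · exact .inr ⟨_, i, hi⟩
  -- The positions filled since `N` are values of `f`. The default 0 is harmless, as the image has
  -- at most `Fintype.card P` elements in any case.
  let f : P → ℕ := fun q => match ((σ t).loc q).pc with
    | .pushRef _ pos => pos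
    | _ => 0
  have hsub : Finset.range (σ t).tail ⊆
      Finset.range ((σ N).tail + kmax) ∪ Finset.univ.image f := by
    intro pos hp
    rw [Finset.mem_range] at hp
    rw [Finset.mem_union, Finset.mem_range, Finset.mem_image]
    rcases key pos ((h.wf t).full pos hp) with hp | ⟨q, i, hi⟩
    · obtain ⟨i, hi⟩ := Option.ne_none_iff_exists'.1 hp
      obtain ⟨it, hit, -, hlt⟩ := (h.wf N).item _ _ hi
      have := ((h.wf N).param i it hit).2
      exact .inl (by omega)
    · exact .inr ⟨q, Finset.mem_univ q, by simp [f, hi]⟩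
  have h1 := (Finset.card_le_card hsub).trans (Finset.card_union_le _ _)
  have h2 := Finset.card_image_le (s := (Finset.univ : Finset P)) (f := f)
  simp only [Finset.card_range, Finset.card_univ] at h1 h2
  omega

/-- Otherwise no `push` returns from some time on: not those of other places by assumption, and not
one of `p`, which stays in a `pop`. Then `tail` is bounded and the weight of the `pop` descends
forever. -/
theorem IsInfRun.frequently_success [Fintype P] (h : IsInfRun prio kmax σ lab) {p : P} {m : ℕ}
    (hpop : ∀ i ≥ m, ((σ i).loc p).pc.IsPop) (hfr : ∃ᶠ i in atTop, (lab i).1 = p) :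
    ∃ᶠ i in atTop, (lab i).1 ≠ p ∧ (lab i).2.IsSuccess := by
  by_contra hcon
  rw [not_frequently, eventually_atTop] at hcon
  obtain ⟨M, hM⟩ := hcon
  set N := max m M
  have hret : ∀ i ≥ N, (lab i).2 ≠ .retPush := by
    intro i hi hl
    refine hM i (le_trans (le_max_right _ _) hi) ⟨fun hp => ?_, by simp [hl, Act.IsSuccess]⟩
    have h1 := hpop i (le_trans (le_max_left _ _) hi)
    have h2 := h.step i
    rw [hl, hp] at h2
    obtain ⟨i', pos, h3⟩ := h2.pc_of_retPush
    simp [h3, PC.IsPop] at h1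
  set B := (σ N).tail + kmax + Fintype.card P
  have hB : ∀ t ≥ N, (σ t).tail ≤ B := fun t ht => h.tail_le hret ht
  have hlt : ∀ t ≥ N, (lab t).1 = p →
      ((σ (t + 1)).loc p).weight B < ((σ t).loc p).weight B := by
    intro t ht hp
    have h1 := h.step t
    rw [hp] at h1
    exact h1.weight_lt (h.wf t) (hpop t (le_trans (le_max_left _ _) ht))
      (hpop _ (le_trans (le_max_left _ _) (Nat.le_succ_of_le ht))) (hB t ht)
  have hle : ∀ t ≥ N, ∀ t' ≥ t, ((σ t').loc p).weight B ≤ ((σ t).loc p).weight B := by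
    intro t ht t' ht'
    induction t', ht' using Nat.le_induction with
    | base => exact le_rfl
    | succ t' ht' ih =>
      refine le_trans ?_ ih
      by_cases hp : (lab t').1 = p
      · exact (hlt t' (ht.trans ht') hp).le
      · rw [(h.step t').loc_eq (Ne.symm hp)]
  -- Infinite descent: steps of other places do not change the weight, and `p` always makes another
  -- step.
  have hno : ∀ v, ∀ t ≥ N, ((σ t).loc p).weight B ≠ v := by
    intro v
    induction v using Nat.strong_induction_on with
    | _ v ih =>
      intro t ht hv
      obtain ⟨i, hi, hp⟩ := frequently_atTop.1 hfr t
      exact ih _ (((hlt i (ht.trans hi) hp).trans_le (hle t ht i hi)).trans_eq hv) (i + 1)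
        (by omega) rfl
  exact hno _ N le_rfl rfl

theorem Act.IsSuccess.isRet {T : Type*} {act : Act T} (h : act.IsSuccess) : act.IsRet := by
  cases act <;> trivial

theorem popLockFree [Fintype P] (prio : T → Q) (hkmax : 1 ≤ kmax) :
    PopLockFree (P := P) prio kmax where
  enabled n σ lab h p hp := (h.wf le_rfl).exists_step hkmax hp
  individual σ lab h p m hpop hfr := h.frequently_success hpop hfr
  system σ lab h hfr := by
    by_contra hcon
    have hcon' := hcon
    rw [not_frequently, eventually_atTop] at hcon'
    obtain ⟨M, hM⟩ := hcon'
    -- Pigeonhole over the finitely many places. Without responses this place then never leaves its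
    -- `pop`.
    have : ∃ p, ∃ᶠ i in atTop, (lab i).1 = p ∧ ((σ i).loc p).pc.IsPop := by
      by_contra hall
      simp only [not_exists, not_frequently] at hall
      refine hfr ((eventually_all.2 hall).mono fun i hi => ?_)
      exact fun hp => hi _ ⟨rfl, hp⟩
    obtain ⟨p, hp⟩ := this
    obtain ⟨m, hm, -, hpm⟩ := frequently_atTop.1 hp M
    refine hcon ((h.frequently_success (p := p) (m := m) (fun i hi => ?_)
      (hp.mono fun i hi => hi.1)).mono fun i hi => hi.2.isRet)
    induction i, hi using Nat.le_induction with
    | base => exact hpm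
    | succ i hi ih => exact (h.step i).isPop ih (hM i (by omega))

end

/-! ### What a single step reveals about the operation it belongs to -/

/-- The invocation labels. -/
def Act.IsInv {T : Type*} : Act T → Prop
  | .invPush _ _ _ | .invPop => True
  | _ => False

/-- The item of the `push` that a place is executing. -/
def PC.pushing? {T : Type*} : PC T → Option ℕ
  | .pushRef i _ => some i
  | c => c.inserting?

/-- The program counters of a `pop` that has scanned the array. -/
def PC.Scanned {T : Type*} : PC T → Prop
  | .popSelect | .popCas _ _ | .popProbe _ | .popProbeCas _ _ _ | .popReturn _ => True
  | _ => False

/-- The item `i` has been taken. -/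
def State.Taken {P T : Type*} (s : State P T) (i : ℕ) : Prop :=
  ∃ it, s.heap i = some it ∧ it.tag = -1

/-- What a `pop` of `p` that scanned the array last in the state `S` knows in the state `s`. -/
def PC.Justified {P T Q : Type*} [LinearOrder Q] (prio : T → Q) (S : State P T) (p : P)
    (s : State P T) : PC T → Prop
  | .popSelect => (s.loc p).queue = (S.loc p).queue ∧ (s.loc p).head = (S.loc p).head
  | .popCas r a => r ∈ (S.loc p).queue ∧
      ∀ r' ∈ (S.loc p).queue, ∀ it, S.heap r'.it = some it → prio it.task ≤ prio a
  | .popProbe _ => (S.loc p).queue = 0 ∧ (s.loc p).head = (S.loc p).head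
  | .popProbeCas pos i _ => (S.loc p).queue = 0 ∧ (S.loc p).head ≤ pos ∧
      ∃ it, s.heap i = some it ∧ pos < (S.loc p).head + it.k
  | .popReturn .empty => (S.loc p).queue = 0
  | .popReturn (.fromQueue i a) =>
      (∃ r ∈ (S.loc p).queue, r.it = i ∧ ∃ it, s.heap i = some it ∧ it.task = a) ∧
      ∀ r' ∈ (S.loc p).queue, ∀ it, S.heap r'.it = some it → prio it.task ≤ prio a
  | .popReturn (.fromProbe i a) => (S.loc p).queue = 0 ∧
      ∃ pos it, s.array pos = some i ∧ s.heap i = some it ∧ it.task = a ∧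
        (S.loc p).head ≤ pos ∧ pos < (S.loc p).head + it.k
  | _ => False

/-- The immutable part of the heap persists. -/
def State.HeapLE {P T : Type*} (s s' : State P T) : Prop :=
  ∀ i it, s.heap i = some it →
    ∃ it', s'.heap i = some it' ∧ it'.place = it.place ∧ it'.k = it.k ∧ it'.task = it.task

section
variable {P T Q : Type*} [DecidableEq P] [LinearOrder Q] {prio : T → Q} {kmax : ℕ}
  {s s' S : State P T} {p : P} {act : Act T}

theorem Step.pc_of_isInv (h : Step prio kmax s p act s') (ha : act.IsInv) :
    (s.loc p).pc = .idle ∧ (s'.loc p).pc ≠ .idle := by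
  cases h <;> simp_all [Act.IsInv, State.setPc, State.setLoc]

theorem Step.pc_ne_idle (h : Step prio kmax s p act s') (ha : ¬ act.IsRet) :
    (s'.loc p).pc ≠ .idle := by
  cases h <;> simp_all [Act.IsRet, State.setPc, State.setLoc]

theorem Step.pc_of_isRet (h : Step prio kmax s p act s') (ha : act.IsRet) :
    (act = .retPush ∧ ∃ i pos, (s.loc p).pc = .pushRef i pos) ∨
      ∃ o, act = .retPop o ∧ (s.loc p).pc = .popReturn o := by
  cases h <;> simp_all [Act.IsRet]

theorem Step.isRet_of_popReturn (h : Step prio kmax s p act s') {o : Outcome T}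
    (ho : (s.loc p).pc = .popReturn o) : act.IsRet ∧ (s'.loc p).pc = .idle := by
  cases h <;> simp_all [Act.IsRet, State.setPc, State.setLoc]

theorem Step.of_invPush {k : ℕ} {a : T} {i : ℕ} (h : Step prio kmax s p (.invPush k a i) s') :
    s.heap i = none ∧ s'.heap i = some ⟨p, k, a, -1⟩ ∧ (s'.loc p).pc = .pushRead i := by
  generalize hact : Act.invPush k a i = act at h
  cases h <;> simp_all [State.setPc, State.setLoc, State.setItem]

theorem Step.of_invPop (h : Step prio kmax s p .invPop s') : (s'.loc p).pc = .popScan := by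
  generalize hact : Act.invPop = act at h
  cases h <;> simp_all [State.setPc, State.setLoc]

theorem Step.invPush_of_heap (h : Step prio kmax s p act s') {i : ℕ} {it : Item P T}
    (hi : s.heap i = none) (hi' : s'.heap i = some it) :
    act = .invPush it.k it.task i ∧ it.place = p := by
  cases h <;> simp only [State.setPc, State.setLoc, State.setItem, Function.update_apply] at hi' <;>
    grind

theorem Step.heapLE (h : Step prio kmax s p act s') : s.HeapLE s' := fun _ _ hi => h.heap_eq hi

theorem Step.pushing (h : Step prio kmax s p act s') (ha : ¬ act.IsInv) {i : ℕ}
    (hi : (s'.loc p).pc.pushing? = some i) : (s.loc p).pc.pushing? = some i ∧ ¬ act.IsRet := by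
  cases h <;> simp_all [Act.IsInv, Act.IsRet, State.setPc, State.setLoc, PC.pushing?,
    PC.inserting?, State.setItem]

theorem Step.isPop_of_isPop (h : Step prio kmax s p act s') (ha : ¬ act.IsInv)
    (hp : (s'.loc p).pc.IsPop) : (s.loc p).pc.IsPop ∧ ¬ act.IsRet := by
  cases h <;> simp_all [Act.IsInv, Act.IsRet, State.setPc, State.setLoc, PC.IsPop, State.setItem]

theorem Step.scanned (h : Step prio kmax s p act s') (hs' : (s'.loc p).pc.Scanned)
    (hn : ¬ ((s.loc p).pc = .popScan ∧ (s'.loc p).pc = .popSelect)) :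
    (s.loc p).pc.Scanned ∧ ¬ act.IsRet := by
  cases h <;> simp_all [Act.IsRet, State.setPc, State.setLoc, PC.Scanned, State.setItem]

theorem Step.inv_cases (h : Step prio kmax s p act s') (ha : act.IsInv) :
    (∃ k a i, act = .invPush k a i) ∨ act = .invPop := by
  cases act <;> simp_all [Act.IsInv]

theorem Step.of_scan (h : Step prio kmax s p act s') (hs : (s.loc p).pc = .popScan)
    (hs' : (s'.loc p).pc = .popSelect) :
    s'.tail ≤ (s'.loc p).head ∧ s'.array = s.array ∧ ¬ act.IsInv ∧ ¬ act.IsRet := by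
  cases h <;> simp_all [State.setPc, State.setLoc, Act.IsInv, Act.IsRet]

/-- The linearization step of a `push`. -/
theorem Step.of_put (h : Step prio kmax s p act s') (w : s.WF kmax) {pos i : ℕ}
    (hn : s.array pos ≠ some i)
    (hi : s'.array pos = some i) :
    s.array pos = none ∧ s'.tail = s.tail ∧ s'.heap = s.heap ∧ (s.loc p).pc ≠ .popScan ∧
      (∃ it, s.heap i = some it ∧ it.tag = (pos : ℤ)) ∧
      ∀ pos', pos' ≠ pos → s'.array pos' = s.array pos' := by
  cases h
  case pushCasOk i t off j it hpc hit hnull =>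
    have h1 := w.pushCas _ _ _ _ _ _ hpc hit
    simp only [State.setPc, State.setLoc, Function.update_apply] at hi ⊢
    grind
  all_goals exact absurd hi hn

/-- The only step that resets a tag to a position is the one before an insertion attempt, and it
concerns an item outside the array. -/
theorem Step.taken (h : Step prio kmax s p act s') (w : s.WF kmax) {pos i : ℕ}
    (hi : s.array pos = some i) (ht : s.Taken i) : s'.Taken i := by
  obtain ⟨it, h1, h2⟩ := ht
  have h3 := w.inserting p
  cases h <;> simp only [State.setPc, State.setLoc, State.setItem, State.Taken,
      Function.update_apply] <;> grind [PC.inserting?]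

theorem Step.of_take (h : Step prio kmax s p act s') (w : s.WF kmax) {pos i : ℕ}
    (hi : s.array pos = some i) (ht : ¬ s.Taken i) (ht' : s'.Taken i) :
    ∃ o a, (s'.loc p).pc = .popReturn o ∧ o.item? = some (i, a) := by
  have h3 := w.inserting p
  cases h
  case popCasOk r a it hpc hi' htag =>
    obtain rfl : i = r.it := by
      by_contra hne
      exact ht (by simpa [State.setPc, State.setLoc, State.setItem, State.Taken, hne] using ht')
    refine ⟨.fromQueue r.it a, a, ?_, rfl⟩
    simp only [State.setPc, State.setLoc, Function.update_self]
  case popProbeCasOk pos' i' a it hpc hi' htag =>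
    obtain rfl : i = i' := by
      by_contra hne
      exact ht (by simpa [State.setPc, State.setLoc, State.setItem, State.Taken, hne] using ht')
    refine ⟨.fromProbe i a, a, ?_, rfl⟩
    simp only [State.setPc, State.setLoc, Function.update_self]
  -- An allocation also writes the tag -1, but to a free address, whereas an item in the array is
  -- already allocated.
  all_goals
    obtain ⟨it, h1, h2, -⟩ := w.item pos i hi
    simp only [State.setPc, State.setLoc, State.setItem, State.Taken,
      Function.update_apply] at ht ht' ⊢
    grind [PC.inserting?]

theorem Step.take_of_popReturn (h : Step prio kmax s p act s') (w : s.WF kmax) {o : Outcome T}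
    {i : ℕ} {a : T} (ho : (s.loc p).pc ≠ .popReturn o) (ho' : (s'.loc p).pc = .popReturn o)
    (hi : o.item? = some (i, a)) :
    (∃ pos, s.array pos = some i) ∧ ¬ s.Taken i ∧ s'.Taken i := by
  have h1 := w.popCas p
  have h2 := w.popProbeCas p
  cases h <;> simp_all only [State.setPc, State.setLoc, State.setItem, State.Taken,
      Function.update_self, reduceCtorEq, PC.popReturn.injEq] <;> subst ho' <;>
      simp only [Outcome.item?, Option.some.injEq, Prod.mk.injEq, reduceCtorEq] at hi
  · obtain ⟨rfl, rfl⟩ := hi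
    refine ⟨⟨_, (h1 _ _ rfl).1⟩, ?_, _, Function.update_self .., rfl⟩
    grind
  · obtain ⟨rfl, rfl⟩ := hi
    refine ⟨⟨_, (h2 _ _ _ rfl).1⟩, ?_, _, Function.update_self .., rfl⟩
    grind

theorem PC.Justified.step_of_ne (h : Step prio kmax s p act s') {q : P} (hq : q ≠ p) {c : PC T}
    (hc : c.Justified prio S q s) : c.Justified prio S q s' := by
  have hl := h.loc_eq hq
  have hh := h.heapLE
  have ha := fun pos i => h.array_eq (pos := pos) (i := i)
  rcases c with _ | _ | _ | _ | _ | _ | _ | _ | _ | _ | _ | _ | (_ | _ | _) <;>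
    simp only [PC.Justified, hl] at hc ⊢ <;> try exact hc
  · obtain ⟨h1, h2, it, h3, h4⟩ := hc
    obtain ⟨it', h5, -, h6, -⟩ := hh _ _ h3
    exact ⟨h1, h2, it', h5, by omega⟩
  · obtain ⟨⟨r, h1, h2, it, h3, h4⟩, h7⟩ := hc
    obtain ⟨it', h5, -, -, h6⟩ := hh _ _ h3
    exact ⟨⟨r, h1, h2, it', h5, h6.trans h4⟩, h7⟩
  · obtain ⟨h1, pos, it, h2, h3, h4, h7, h8⟩ := hc
    obtain ⟨it', h5, -, h6, h6'⟩ := hh _ _ h3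
    exact ⟨h1, pos, it', ha _ _ h2, h5, h6'.trans h4, h7, by omega⟩

/-- After the scan the queue changes only by the selection, so the selected task is maximal in the
queue of the scan; tasks are immutable, so priorities may be read in either state. A failed CAS on a
queued item discards this knowledge and leads to a new scan. -/
theorem PC.Justified.step (h : Step prio kmax s p act s') (w : s.WF kmax) (hS : S.HeapLE s)
    (hc : (s.loc p).pc.Justified prio S p s) :
    (s'.loc p).pc = .popScan ∨ (s'.loc p).pc = .idle ∨ (s'.loc p).pc.Justified prio S p s' := by
  have h1 := w.popCas p
  have h2 := w.popProbeCas p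
  cases h
  case popSelect r c it hpc hq hi hmax =>
    simp only [hpc, PC.Justified] at hc
    refine .inr (.inr ?_)
    simp only [State.setLoc, Function.update_self, PC.Justified, ← hc.1, hq, Multiset.mem_cons]
    refine ⟨by simp, ?_⟩
    rintro r' (rfl | hr') it' hit' <;> obtain ⟨it'', h3, -, -, h4⟩ := hS _ _ hit'
    · rw [← h4]; exact (congrArg (fun x => prio x.task) (Option.some.inj (h3.symm.trans hi))).le
    · rw [← h4]; exact hmax r' hr' it'' h3
  case popCasOk r a it hpc hi ht =>
    simp only [hpc, PC.Justified] at hc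
    refine .inr (.inr ?_)
    simp only [State.setPc, State.setLoc, State.setItem, Function.update_self, PC.Justified]
    obtain ⟨-, it', h3, h4⟩ := h1 _ _ hpc
    exact ⟨⟨r, hc.1, rfl, _, rfl, by grind⟩, hc.2⟩
  case popProbeCasOk pos i a it hpc hi ht =>
    simp only [hpc, PC.Justified] at hc
    refine .inr (.inr ?_)
    simp only [State.setPc, State.setLoc, State.setItem, Function.update_self, PC.Justified]
    obtain ⟨h5, it', h3, h4⟩ := h2 _ _ _ hpc
    exact ⟨hc.1, pos, _, h5, rfl, by grind, hc.2.1, by grind⟩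
  all_goals
    simp_all only [PC.Justified, State.setPc, State.setLoc, Function.update_self,
      reduceCtorEq, true_or, or_true, false_or, true_and]
  all_goals grind
end
-- Histories in a run: invocations, scans, insertions, decisions
/-- The place `p` has not responded since its step `j`. -/
def OpenSince {P T : Type*} (lab : ℕ → P × Act T) (p : P) (j t : ℕ) : Prop :=
  j < t ∧ (lab j).1 = p ∧ ∀ l, j < l → l < t → (lab l).1 = p → ¬ (lab l).2.IsRet

/-- Step `t` ends a scan of the array by `p`. -/
def IsScan {P T : Type*} (σ : ℕ → State P T) (lab : ℕ → P × Act T) (p : P) (t : ℕ) : Prop :=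
  (lab t).1 = p ∧ ((σ t).loc p).pc = .popScan ∧ ((σ (t + 1)).loc p).pc = .popSelect

/-- Step `s` ends the last scan of the array by `p` before the state `t`. -/
def LastScan {P T : Type*} (σ : ℕ → State P T) (lab : ℕ → P × Act T) (p : P) (s t : ℕ) : Prop :=
  s < t ∧ IsScan σ lab p s ∧ ∀ l, s < l → l < t → ¬ IsScan σ lab p l

/-- Step `c` of `p` determines the outcome `o` of its `pop`. -/
def Decides {P T : Type*} (σ : ℕ → State P T) (lab : ℕ → P × Act T) (p : P) (o : Outcome T)
    (c : ℕ) : Prop :=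
  (lab c).1 = p ∧ ((σ c).loc p).pc ≠ .popReturn o ∧ ((σ (c + 1)).loc p).pc = .popReturn o

/-- The index of the first state in which the item `i` is in the array. -/
noncomputable def putTime {P T : Type*} (σ : ℕ → State P T) (i : ℕ) : ℕ :=
  sInf {t | ∃ pos, (σ t).array pos = some i}

section
variable {P T : Type*} {σ : ℕ → State P T} {lab : ℕ → P × Act T} {p : P}

theorem OpenSince.succ {j t : ℕ} (h : OpenSince lab p j t)
    (ht : (lab t).1 = p → ¬ (lab t).2.IsRet) : OpenSince lab p j (t + 1) := by
  refine ⟨by have := h.1; omega, h.2.1, fun l hl hl' hp => ?_⟩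
  rcases Nat.lt_succ_iff_lt_or_eq.1 hl' with hl' | rfl
  · exact h.2.2 l hl hl' hp
  · exact ht hp

theorem OpenSince.self (t : ℕ) : OpenSince lab (lab t).1 t (t + 1) :=
  ⟨by omega, rfl, fun l hl hl' => by omega⟩

theorem LastScan.succ {s t : ℕ} (h : LastScan σ lab p s t) (ht : ¬ IsScan σ lab p t) :
    LastScan σ lab p s (t + 1) := by
  refine ⟨by have := h.1; omega, h.2.1, fun l hl hl' => ?_⟩
  rcases Nat.lt_succ_iff_lt_or_eq.1 hl' with hl' | rfl
  · exact h.2.2 l hl hl'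
  · exact ht

theorem LastScan.unique {s s' t : ℕ} (h : LastScan σ lab p s t) (h' : LastScan σ lab p s' t) :
    s = s' := by
  rcases lt_trichotomy s s' with hs | hs | hs
  · exact absurd h'.2.1 (h.2.2 s' hs h'.1)
  · exact hs
  · exact absurd h.2.1 (h'.2.2 s hs h.1)

theorem putTime_le {t pos i : ℕ} (hi : (σ t).array pos = some i) : putTime σ i ≤ t :=
  Nat.sInf_le ⟨pos, hi⟩

end

section
variable {P T Q : Type*} [DecidableEq P] [LinearOrder Q] {prio : T → Q} {kmax n : ℕ}
  {σ : ℕ → State P T} {lab : ℕ → P × Act T} {p : P}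

namespace IsRun

theorem array_mono (h : IsRun prio kmax n σ lab) {t t' : ℕ} (htt : t ≤ t') (ht : t' ≤ n)
    {pos i : ℕ} (hi : (σ t).array pos = some i) : (σ t').array pos = some i := by
  induction t', htt using Nat.le_induction with
  | base => exact hi
  | succ t' htt ih => exact (h.2 t' (by omega)).array_eq (ih (by omega))

theorem tail_mono (h : IsRun prio kmax n σ lab) {t t' : ℕ} (htt : t ≤ t') (ht : t' ≤ n) :
    (σ t).tail ≤ (σ t').tail := by
  induction t', htt using Nat.le_induction with
  | base => exact le_rfl
  | succ t' htt ih => exact (ih (by omega)).trans (h.2 t' (by omega)).tail_le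

theorem heap_mono (h : IsRun prio kmax n σ lab) {t t' : ℕ} (htt : t ≤ t') (ht : t' ≤ n) :
    (σ t).HeapLE (σ t') := by
  induction t', htt using Nat.le_induction with
  | base => exact fun i it hi => ⟨it, hi, rfl, rfl, rfl⟩
  | succ t' htt ih =>
    intro i it hi
    obtain ⟨it₁, h1, h2, h3, h4⟩ := ih (by omega) i it hi
    obtain ⟨it₂, h5, h6, h7, h8⟩ := (h.2 t' (by omega)).heapLE i it₁ h1
    exact ⟨it₂, h5, h6.trans h2, h7.trans h3, h8.trans h4⟩

theorem taken_mono (h : IsRun prio kmax n σ lab) {t t' : ℕ} (htt : t ≤ t') (ht : t' ≤ n)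
    {pos i : ℕ} (hi : (σ t).array pos = some i) (hT : (σ t).Taken i) : (σ t').Taken i := by
  induction t', htt using Nat.le_induction with
  | base => exact hT
  | succ t' htt ih =>
    exact (h.2 t' (by omega)).taken (h.wf (by omega)) (h.array_mono htt (by omega) hi)
      (ih (by omega))

/-- Between its invocation and its response a place is not idle. -/
theorem pc_ne_idle (h : IsRun prio kmax n σ lab) {j t : ℕ} (ht : t ≤ n)
    (ho : OpenSince lab p j t) (hj : (lab j).2.IsInv) : ((σ t).loc p).pc ≠ .idle := by
  obtain ⟨hjt, rfl, ho⟩ := ho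
  induction t, (show j + 1 ≤ t from hjt) using Nat.le_induction with
  | base => exact ((h.2 j (by omega)).pc_of_isInv hj).2
  | succ t hjt' ih =>
    have hs := h.2 t (by omega)
    by_cases hp : (lab t).1 = (lab j).1
    · rw [← hp]
      exact hs.pc_ne_idle (ho t hjt' (by omega) hp)
    · rw [hs.loc_eq (Ne.symm hp)]
      exact ih (by omega) hjt' fun l hl hl' => ho l hl (by omega)

theorem openSince_not_isInv (h : IsRun prio kmax n σ lab) {j j' t : ℕ} (ht : t ≤ n)
    (ho : OpenSince lab p j t) (hj : (lab j).2.IsInv) (hjj : j < j') (hj' : j' < t)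
    (hp : (lab j').1 = p) : ¬ (lab j').2.IsInv := by
  intro hi
  have h1 := ((h.2 j' (by omega)).pc_of_isInv hi).1
  rw [hp] at h1
  exact h.pc_ne_idle (t := j') (by omega) ⟨hjj, ho.2.1, fun l hl hl' => ho.2.2 l hl (by omega)⟩
    hj h1

theorem openSince_unique (h : IsRun prio kmax n σ lab) {j j' t t' : ℕ} (ht : t ≤ n)
    (ht' : t' ≤ n) (hjt : j < t') (hjt' : j' < t)
    (ho : OpenSince lab p j t) (hj : (lab j).2.IsInv)
    (ho' : OpenSince lab p j' t') (hj' : (lab j').2.IsInv) : j = j' := by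
  rcases lt_trichotomy j j' with hs | hs | hs
  · exact absurd hj' (h.openSince_not_isInv ht ho hj hs hjt' ho'.2.1)
  · exact hs
  · exact absurd hj (h.openSince_not_isInv ht' ho' hj' hs hjt ho.2.1)

/-- A place that executes a `push` has invoked it. -/
theorem exists_invPush (h : IsRun prio kmax n σ lab) {t : ℕ} (ht : t ≤ n) {i : ℕ}
    (hi : ((σ t).loc p).pc.pushing? = some i) :
    ∃ j k a, (lab j).2 = .invPush k a i ∧ OpenSince lab p j t := by
  induction t with
  | zero => simp [h.1, State.init, PC.pushing?, PC.inserting?] at hi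
  | succ t ih =>
    have hs := h.2 t ht
    by_cases hp : (lab t).1 = p
    · subst hp
      by_cases ha : (lab t).2.IsInv
      · rcases hs.inv_cases ha with ⟨k, a, i', he⟩ | he
        · rw [he] at hs
          rw [hs.of_invPush.2.2] at hi
          obtain rfl : i' = i := by simpa [PC.pushing?, PC.inserting?] using hi
          exact ⟨t, k, a, he, .self t⟩
        · rw [he] at hs
          simp [hs.of_invPop, PC.pushing?, PC.inserting?] at hi
      · obtain ⟨h1, h2⟩ := hs.pushing ha hi
        obtain ⟨j, k, a, h3, h4⟩ := ih (by omega) h1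
        exact ⟨j, k, a, h3, h4.succ fun _ => h2⟩
    · rw [hs.loc_eq (Ne.symm hp)] at hi
      obtain ⟨j, k, a, h3, h4⟩ := ih (by omega) hi
      exact ⟨j, k, a, h3, h4.succ fun h => absurd h hp⟩

/-- A place that executes a `pop` has invoked it. -/
theorem exists_invPop (h : IsRun prio kmax n σ lab) {t : ℕ} (ht : t ≤ n)
    (hi : ((σ t).loc p).pc.IsPop) :
    ∃ j, (lab j).2 = .invPop ∧ OpenSince lab p j t := by
  induction t with
  | zero => simp [h.1, State.init, PC.IsPop] at hi
  | succ t ih =>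
    have hs := h.2 t ht
    by_cases hp : (lab t).1 = p
    · subst hp
      by_cases ha : (lab t).2.IsInv
      · rcases hs.inv_cases ha with ⟨k, a, i', he⟩ | he
        · rw [he] at hs
          simp [hs.of_invPush.2.2, PC.IsPop] at hi
        · exact ⟨t, he, .self t⟩
      · obtain ⟨h1, h2⟩ := hs.isPop_of_isPop ha hi
        obtain ⟨j, h3, h4⟩ := ih (by omega) h1
        exact ⟨j, h3, h4.succ fun _ => h2⟩
    · rw [hs.loc_eq (Ne.symm hp)] at hi
      obtain ⟨j, h3, h4⟩ := ih (by omega) hi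
      exact ⟨j, h3, h4.succ fun h => absurd h hp⟩

/-- A `pop` that has scanned the array knows what its last scan has justified. -/
theorem exists_lastScan (h : IsRun prio kmax n σ lab) {t : ℕ} (ht : t ≤ n)
    (hi : ((σ t).loc p).pc.Scanned) :
    ∃ j s, (lab j).2 = .invPop ∧ OpenSince lab p j t ∧ j < s ∧ LastScan σ lab p s t ∧
      ((σ t).loc p).pc.Justified prio (σ (s + 1)) p (σ t) := by
  induction t with
  | zero => simp [h.1, State.init, PC.Scanned] at hi
  | succ t ih =>
    have hs := h.2 t ht
    by_cases hp : (lab t).1 = p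
    · by_cases hsc : IsScan σ lab p t
      · obtain ⟨rfl, h1, h2⟩ := hsc
        obtain ⟨j, h3, h4⟩ := h.exists_invPop (p := (lab t).1) (t := t) (by omega)
          (by simp [h1, PC.IsPop])
        refine ⟨j, t, h3, h4.succ fun _ => (hs.of_scan h1 h2).2.2.2, h4.1,
          ⟨by omega, ⟨rfl, h1, h2⟩, fun l hl hl' => by omega⟩, ?_⟩
        simp [h2, PC.Justified]
      · have h1 : ((σ t).loc p).pc.Scanned ∧ ¬ (lab t).2.IsRet := by
          clear ih
          subst hp
          have hsc' : ¬ (((σ t).loc (lab t).1).pc = .popScan ∧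
            ((σ (t + 1)).loc (lab t).1).pc = .popSelect) := fun hc => hsc ⟨rfl, hc⟩
          exact hs.scanned hi hsc'
        obtain ⟨j, s, h3, h4, h5, h6, h7⟩ := ih (by omega) h1.1
        refine ⟨j, s, h3, h4.succ fun _ => h1.2, h5, h6.succ hsc, ?_⟩
        subst hp
        have hlt := h6.1
        rcases h7.step hs (h.wf (by omega)) (h.heap_mono (by omega) (by omega)) with h8 | h8 | h8
        · simp [h8, PC.Scanned] at hi
        · simp [h8, PC.Scanned] at hi
        · exact h8
    · rw [hs.loc_eq (Ne.symm hp)] at hi ⊢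
      obtain ⟨j, s, h3, h4, h5, h6, h7⟩ := ih (by omega) hi
      exact ⟨j, s, h3, h4.succ fun h => absurd h hp, h5, h6.succ fun h => hp h.1,
        h7.step_of_ne hs (Ne.symm hp)⟩

/-- The outcome of a `pop` has been determined by an earlier step. -/
theorem exists_decides (h : IsRun prio kmax n σ lab) {t : ℕ} (ht : t ≤ n) {o : Outcome T}
    (hi : ((σ t).loc p).pc = .popReturn o) :
    ∃ c < t, Decides σ lab p o c ∧ ∀ l, c < l → l < t → (lab l).1 ≠ p := by
  induction t with
  | zero => simp [h.1, State.init] at hi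
  | succ t ih =>
    have hs := h.2 t ht
    by_cases hp : (lab t).1 = p
    · refine ⟨t, by omega, ⟨hp, fun ho => ?_, hi⟩, fun l hl hl' => by omega⟩
      rw [← hp] at hi ho
      simp [(hs.isRet_of_popReturn ho).2] at hi
    · rw [hs.loc_eq (Ne.symm hp)] at hi
      obtain ⟨c, h1, h2, h3⟩ := ih (by omega) hi
      refine ⟨c, by omega, h2, fun l hl hl' => ?_⟩
      rcases Nat.lt_succ_iff_lt_or_eq.1 hl' with hl' | rfl
      · exact h3 l hl hl'
      · exact hp

theorem popReturn_mono (h : IsRun prio kmax n σ lab) {t t' : ℕ} (htt : t ≤ t') (ht : t' ≤ n)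
    {o : Outcome T} (hi : ((σ t).loc p).pc = .popReturn o)
    (hr : ∀ l, t ≤ l → l < t' → (lab l).1 = p → ¬ (lab l).2.IsRet) :
    ((σ t').loc p).pc = .popReturn o := by
  induction t', htt using Nat.le_induction with
  | base => exact hi
  | succ t' htt ih =>
    have hs := h.2 t' ht
    have h1 := ih (by omega) fun l hl hl' => hr l hl (by omega)
    by_cases hp : (lab t').1 = p
    · have := hr t' htt (by omega) hp
      subst hp
      exact absurd (hs.isRet_of_popReturn h1).1 this
    · rwa [hs.loc_eq (Ne.symm hp)]

/-- An item in the heap has been allocated by a `push`. -/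
theorem exists_alloc (h : IsRun prio kmax n σ lab) {t : ℕ} (ht : t ≤ n) {i : ℕ}
    {it : Item P T} (hi : (σ t).heap i = some it) :
    ∃ j < t, (lab j).2 = .invPush it.k it.task i := by
  induction t generalizing it with
  | zero => simp [h.1, State.init] at hi
  | succ t ih =>
    have hs := h.2 t ht
    rcases hh : (σ t).heap i with _ | it'
    · exact ⟨t, by omega, (hs.invPush_of_heap hh hi).1⟩
    · obtain ⟨it'', h1, h2, h3, h4⟩ := hs.heap_eq hh
      obtain rfl : it'' = it := by simpa [hi] using h1.symm
      obtain ⟨j, h5, h6⟩ := ih (by omega) hh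
      exact ⟨j, by omega, by rw [h6, h3, h4]⟩

theorem heap_of_invPush (h : IsRun prio kmax n σ lab) {j k i t : ℕ} {a : T}
    (hj : (lab j).2 = .invPush k a i) (hjt : j < t) (ht : t ≤ n) :
    ∃ it, (σ t).heap i = some it ∧ it.k = k ∧ it.task = a := by
  have hs := h.2 j (by omega)
  rw [hj] at hs
  obtain ⟨it, h1, -, h2, h3⟩ := h.heap_mono (show j + 1 ≤ t from hjt) ht _ _ hs.of_invPush.2.1
  exact ⟨it, h1, h2, h3⟩

/-- An allocation uses a free address and allocated cells persist. Hence an address identifies its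
`push`. -/
theorem lt_of_heap (h : IsRun prio kmax n σ lab) {j k i t : ℕ} {a : T} {it : Item P T}
    (hj : (lab j).2 = .invPush k a i) (hjn : j < n) (hi : (σ t).heap i = some it) : j < t := by
  by_contra hlt
  have hs := h.2 j hjn
  rw [hj] at hs
  obtain ⟨it', h1, -⟩ := h.heap_mono (not_lt.1 hlt) hjn.le _ _ hi
  simp [hs.of_invPush.1] at h1

theorem invPush_unique (h : IsRun prio kmax n σ lab) {j j' k k' i : ℕ} {a a' : T}
    (hj : (lab j).2 = .invPush k a i) (hj' : (lab j').2 = .invPush k' a' i)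
    (hjn : j < n) (hjn' : j' < n) : j = j' := by
  have h1 : ∀ {j j' k k' a a'}, (lab j).2 = .invPush k a i → (lab j').2 = .invPush k' a' i →
      j < n → j' < n → j ≤ j' := by
    intro j j' k k' a a' hj hj' hjn hjn'
    obtain ⟨it, h1, -⟩ := h.heap_of_invPush hj' (Nat.lt_succ_self j') hjn'
    exact Nat.le_of_lt_succ (h.lt_of_heap hj hjn h1)
  exact le_antisymm (h1 hj hj' hjn hjn') (h1 hj' hj hjn' hjn)

theorem array_putTime (h : IsRun prio kmax n σ lab) {t pos i : ℕ} (ht : t ≤ n)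
    (hi : (σ t).array pos = some i) : (σ (putTime σ i)).array pos = some i := by
  obtain ⟨pos', h1⟩ : ∃ pos', (σ (putTime σ i)).array pos' = some i :=
    Nat.sInf_mem (s := {t | ∃ pos, (σ t).array pos = some i}) ⟨t, pos, hi⟩
  have h2 := h.array_mono (putTime_le hi) ht h1
  rwa [← (h.wf ht).inj _ _ _ h2 hi]

/-- The step that inserts an item into the array. -/
theorem exists_put (h : IsRun prio kmax n σ lab) {t pos i : ℕ} (ht : t ≤ n)
    (hi : (σ t).array pos = some i) :
    ∃ u < t, putTime σ i = u + 1 ∧ (∀ pos', (σ u).array pos' ≠ some i) ∧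
      (σ u).array pos = none ∧ (σ (u + 1)).tail = (σ u).tail ∧
      ((σ u).loc (lab u).1).pc ≠ .popScan ∧ ¬ (σ (u + 1)).Taken i ∧
      ∀ pos', pos' ≠ pos → (σ (u + 1)).array pos' = (σ u).array pos' := by
  have h1 := h.array_putTime ht hi
  have h2 := putTime_le hi
  obtain ⟨u, hu⟩ : ∃ u, putTime σ i = u + 1 := by
    refine Nat.exists_eq_succ_of_ne_zero fun h0 => ?_
    rw [h0, h.1] at h1
    simp [State.init] at h1
  have hne : ∀ pos', (σ u).array pos' ≠ some i := fun pos' hp => by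
    have := putTime_le hp
    omega
  rw [hu] at h1 h2
  obtain ⟨h3, h4, h5, h6, ⟨it, h7, h8⟩, h9⟩ :=
    (h.2 u (by omega)).of_put (h.wf (by omega)) (hne pos) h1
  refine ⟨u, h2, hu, hne, h3, h4, h6, ?_, h9⟩
  rintro ⟨it', h10, h11⟩
  rw [h5, h7, Option.some.injEq] at h10
  subst h10
  omega

/-- A taken item has been taken by a step that determines the outcome of a `pop`. -/
theorem exists_take (h : IsRun prio kmax n σ lab) {t pos i : ℕ} (ht : t ≤ n)
    (hi : (σ t).array pos = some i) (hT : (σ t).Taken i) :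
    ∃ c < t, (∃ o a, Decides σ lab (lab c).1 o c ∧ o.item? = some (i, a)) ∧
      putTime σ i ≤ c := by
  induction t with
  | zero => simp [h.1, State.init] at hi
  | succ t ih =>
    have hs := h.2 t ht
    by_cases hi' : (σ t).array pos = some i
    · by_cases hT' : (σ t).Taken i
      · obtain ⟨c, h1, h2⟩ := ih (by omega) hi' hT'
        exact ⟨c, by omega, h2⟩
      · obtain ⟨o, a, h1, h2⟩ := hs.of_take (h.wf (by omega)) hi' hT' hT
        refine ⟨t, by omega, ⟨o, a, ⟨rfl, fun h3 => ?_, h1⟩, h2⟩, putTime_le hi'⟩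
        simp [(hs.isRet_of_popReturn h3).2] at h1
    -- The item entered the array with the present step, and an insertion leaves its item untaken.
    · obtain ⟨u, h1, h2, -, -, -, -, h3, -⟩ := h.exists_put ht hi
      have : u = t := by
        by_contra hne
        refine hi' (h.array_mono (show u + 1 ≤ t by omega) (by omega) ?_)
        rw [← h2]
        exact h.array_putTime ht hi
      subst this
      exact absurd hT h3

theorem take_of_decides (h : IsRun prio kmax n σ lab) {c : ℕ} (hc : c < n) {o : Outcome T}
    {i : ℕ} {a : T} (hd : Decides σ lab p o c) (hi : o.item? = some (i, a)) :
    (∃ pos, (σ c).array pos = some i) ∧ ¬ (σ c).Taken i ∧ (σ (c + 1)).Taken i := by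
  obtain ⟨rfl, h1, h2⟩ := hd
  exact (h.2 c hc).take_of_popReturn (h.wf hc.le) h1 h2 hi

/-- An item is taken only once. -/
theorem take_unique (h : IsRun prio kmax n σ lab) {c c' : ℕ} (hc : c < n) (hc' : c' < n)
    {o o' : Outcome T} {i : ℕ} {a a' : T} {p p' : P} (hd : Decides σ lab p o c)
    (hd' : Decides σ lab p' o' c') (hi : o.item? = some (i, a)) (hi' : o'.item? = some (i, a')) :
    c = c' := by
  have key : ∀ {c c' o o' a a' p p'}, c < n → c' < n → Decides σ lab p o c →
      Decides σ lab p' o' c' → o.item? = some (i, a) → o'.item? = some (i, a') → ¬ c < c' := by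
    intro c c' o o' a a' p p' hc hc' hd hd' hi hi' hlt
    obtain ⟨⟨pos, h1⟩, -, h2⟩ := h.take_of_decides hc hd hi
    obtain ⟨-, h3, -⟩ := h.take_of_decides hc' hd' hi'
    exact h3 (h.taken_mono hlt hc'.le ((h.2 c hc).array_eq h1) h2)
  have h1 := key hc hc' hd hd' hi hi'
  have h2 := key hc' hc hd' hd hi' hi
  omega

end IsRun
end
-- Sorted lists of entries and the sequential object
/-- The place of an entry in the linearization: a `push` precedes a `pop` with the same
linearization point. -/
def Entry.key {T : Type*} (e : Entry T) : ℕ :=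
  2 * e.pt + match e.op with
    | .push _ => 0
    | .pop _ => 1

section
variable {T : Type*}

theorem Entry.key_of_push {e : Entry T} {x : ℕ × T} (h : e.op = .push x) : e.key = 2 * e.pt := by
  simp [Entry.key, h]

theorem Entry.key_of_pop {e : Entry T} {o : Outcome T} (h : e.op = .pop o) :
    e.key = 2 * e.pt + 1 := by
  simp [Entry.key, h]

/-- Bounded injective keys leave only finitely many elements, which are enumerated by running
through the possible keys. -/
theorem exists_sorted_list {α : Type*} (E : α → Prop) (key : α → ℕ) (N : ℕ)
    (hN : ∀ e, E e → key e < N) (hinj : ∀ e e', E e → E e' → key e = key e' → e = e') :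
    ∃ L : List α, (∀ e, e ∈ L ↔ E e) ∧ L.Pairwise (fun e e' => key e < key e') := by
  classical
  let f : ℕ → Option α := fun m => if h : ∃ e, E e ∧ key e = m then some h.choose else none
  have hf : ∀ m e, f m = some e ↔ E e ∧ key e = m := by
    intro m e
    by_cases h : ∃ e, E e ∧ key e = m
    · have h1 := h.choose_spec
      simp only [f, h, dite_true, Option.some.injEq]
      constructor
      · rintro rfl
        exact h1
      · rintro ⟨h2, h3⟩
        exact hinj _ _ h1.1 h2 (h1.2.trans h3.symm)
    · simp only [f, h, dite_false, reduceCtorEq, false_iff]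
      exact fun h1 => h ⟨e, h1⟩
  refine ⟨(List.range N).filterMap f, fun e => ?_, ?_⟩
  · simp only [List.mem_filterMap, List.mem_range, hf]
    exact ⟨fun ⟨m, _, h, _⟩ => h, fun h => ⟨_, hN e h, h, rfl⟩⟩
  · rw [List.pairwise_filterMap]
    refine List.pairwise_lt_range.imp fun {m m'} hm e he e' he' => ?_
    rw [((hf _ _).1 he).2, ((hf _ _).1 he').2]
    exact hm

/-- This turns "earlier in the linearization" into an inequality between keys, which is how all
later arguments treat the order. -/
theorem mem_left_iff {α : Type*} {key : α → ℕ} {L L₁ L₂ : List α} {e e' : α}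
    (hL : L.Pairwise (fun e e' => key e < key e')) (h : L = L₁ ++ e :: L₂) :
    e' ∈ L₁ ↔ e' ∈ L ∧ key e' < key e := by
  subst h
  rw [List.pairwise_append, List.pairwise_cons] at hL
  constructor
  · exact fun h => ⟨by simp [h], hL.2.2 _ h _ (by simp)⟩
  · rintro ⟨h, hlt⟩
    rcases List.mem_append.1 h with h | h
    · exact h
    · rcases List.mem_cons.1 h with rfl | h
      · omega
      · have := hL.2.1.1 _ h
        omega

theorem mem_right_of_lt {α : Type*} {key : α → ℕ} {L₁ L₂ : List α} {e e' : α}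
    (hL : (L₁ ++ e :: L₂).Pairwise (fun e e' => key e < key e')) (h : e' ∈ L₁ ++ e :: L₂)
    (hlt : key e < key e') : e' ∈ L₂ := by
  rw [List.pairwise_append, List.pairwise_cons] at hL
  rcases List.mem_append.1 h with h | h
  · have := hL.2.2 _ h e (by simp)
    omega
  · rcases List.mem_cons.1 h with rfl | h
    · omega
    · exact h

theorem contents_concat (L : List (Op T)) (op : Op T) :
    contents (L ++ [op]) = op.apply (contents L) := by
  simp [contents]

/-- A stored element has been pushed and not been popped since. -/
theorem exists_of_mem_contents {L : List (Entry T)} {y : ℕ × T}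
    (h : y ∈ contents (L.map Entry.op)) :
    ∃ A e B, L = A ++ e :: B ∧ e.op = .push y ∧
      ∀ e' ∈ B, ∀ o, e'.op = .pop o → o.item? ≠ some y := by
  induction L using List.reverseRecOn with
  | nil => simp [contents] at h
  | append_singleton L e ih =>
    rw [List.map_append, List.map_singleton, contents_concat] at h
    have key : y ∈ contents (L.map Entry.op) → (∀ o, e.op = .pop o → o.item? ≠ some y) →
        ∃ A e' B, L ++ [e] = A ++ e' :: B ∧ e'.op = .push y ∧
          ∀ e' ∈ B, ∀ o, e'.op = .pop o → o.item? ≠ some y := by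
      intro h he
      obtain ⟨A, e', B, rfl, h1, h2⟩ := ih h
      refine ⟨A, e', B ++ [e], by simp, h1, fun e'' he'' => ?_⟩
      rcases List.mem_append.1 he'' with he'' | he''
      · exact h2 _ he''
      · rw [List.mem_singleton.1 he'']
        exact he
    rcases hop : e.op with x | o
    · rw [hop] at h
      rcases h with rfl | h
      · exact ⟨L, e, [], rfl, hop, by simp⟩
      · exact key h (by simp [hop])
    · rw [hop] at h
      refine key h.1 fun o' ho' => ?_
      rw [hop, Op.pop.injEq] at ho'
      exact ho' ▸ h.2

/-- A pushed element that has not been popped is stored. -/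
theorem mem_contents {L : List (Entry T)} {y : ℕ × T} (h : ∃ e ∈ L, e.op = .push y)
    (hp : ∀ e ∈ L, ∀ o, e.op = .pop o → o.item? ≠ some y) :
    y ∈ contents (L.map Entry.op) := by
  induction L using List.reverseRecOn with
  | nil => simp at h
  | append_singleton L e ih =>
    rw [List.map_append, List.map_singleton, contents_concat]
    rcases hop : e.op with x | o
    · by_cases hx : y = x
      · exact .inl hx
      · refine .inr (ih ?_ fun e he => hp e (by simp [he]))
        obtain ⟨e', he', h1⟩ := h
        rcases List.mem_append.1 he' with he' | he'
        · exact ⟨e', he', h1⟩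
        · rw [List.mem_singleton.1 he', hop, Op.push.injEq] at h1
          exact absurd h1.symm hx
    · refine ⟨ih ?_ fun e he => hp e (by simp [he]), hp e (by simp) o hop⟩
      obtain ⟨e', he', h1⟩ := h
      rcases List.mem_append.1 he' with he' | he'
      · exact ⟨e', he', h1⟩
      · rw [List.mem_singleton.1 he', hop] at h1
        cases h1

theorem mem_pushed {L : List (Entry T)} {y : ℕ × T} :
    y ∈ pushed (L.map Entry.op) ↔ ∃ e ∈ L, e.op = .push y := by
  simp only [pushed, List.mem_filterMap, List.mem_map, exists_exists_and_eq_and]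
  refine exists_congr fun e => and_congr_right fun _ => ?_
  rcases e.op with x | o <;> simp [Op.pushed?]

theorem pushed_split {A B : List (Entry T)} {e : Entry T} {y : ℕ × T} (h : e.op = .push y) :
    pushed ((A ++ e :: B).map Entry.op) =
      pushed (A.map Entry.op) ++ y :: pushed (B.map Entry.op) := by
  simp [pushed, h, Op.pushed?]

theorem nodup_pushed {L : List (Entry T)} (hL : L.Pairwise (fun e e' => e.key < e'.key))
    (hinj : ∀ e ∈ L, ∀ e' ∈ L, ∀ y, e.op = .push y → e'.op = .push y → e = e') :
    (pushed (L.map Entry.op)).Nodup := by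
  rw [pushed, List.filterMap_map, List.Nodup, List.pairwise_filterMap]
  refine hL.imp_of_mem fun {e e'} he he' hlt y hy y' hy' => ?_
  have h1 : ∀ {e : Entry T} {y}, (Op.pushed? ∘ Entry.op) e = some y → e.op = .push y := by
    intro e y h
    rcases hop : e.op with x | o <;> simp_all [Op.pushed?]
  rintro rfl
  rw [hinj e he e' he' y (h1 hy) (h1 hy')] at hlt
  omega

theorem mem_rtake {α : Type*} {A B : List α} {y : α} {k : ℕ} (h : (y :: B).length ≤ k) :
    y ∈ (A ++ y :: B).rtake k := by
  have h1 : (A ++ y :: B).length - k ≤ A.length := by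
    rw [List.length_append]
    omega
  rw [List.rtake, List.drop_append_of_le_length h1]
  simp

/-- It is applied to two values of `tail`, both multiples of a uniform parameter, to show that
`tail` has not moved. -/
theorem eq_of_dvd_of_lt_add {k a b : ℕ} (ha : k ∣ a) (hb : k ∣ b) (hab : a ≤ b)
    (hlt : b < a + k) : a = b := by
  have h1 := Nat.eq_zero_of_dvd_of_lt (Nat.dvd_sub hb ha) (by omega)
  omega

end

/-! ### Counting elements by array positions -/

section
variable {P T : Type*} {s : State P T}

/-- An array position determines the address stored there and thereby the task, so there are no more
elements than positions. -/
theorem afterTail_of_forall {K : ℕ} {Y : Set (ℕ × T)}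
    (h : ∀ y ∈ Y, ∃ pos it, s.tail ≤ pos ∧ pos < s.tail + K ∧ s.array pos = some y.1 ∧
      s.heap y.1 = some it ∧ it.task = y.2) : AfterTail s K Y := by
  refine ⟨?_, fun y hy => ?_⟩
  · let g : ℕ → Option (ℕ × T) := fun pos =>
      (s.array pos).bind fun i => (s.heap i).map fun it => (i, it.task)
    have h1 : some '' Y ⊆ g '' (Finset.Ico s.tail (s.tail + K) : Finset ℕ) := by
      rintro _ ⟨y, hy, rfl⟩
      obtain ⟨pos, it, h1, h2, h3, h4, h5⟩ := h y hy
      exact ⟨pos, by simp [h1, h2], by simp [g, h3, h4, h5]⟩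
    calc Y.encard = (some '' Y).encard := ((Option.some_injective _).encard_image Y).symm
      _ ≤ _ := Set.encard_le_encard h1
      _ ≤ _ := Set.encard_image_le _ _
      _ = K := by rw [Set.encard_coe_eq_coe_finsetCard, Nat.card_Ico, Nat.add_sub_cancel_left]
  · obtain ⟨pos, it, h1, h2, h3, -⟩ := h y hy
    exact ⟨pos, h1, h2, h3⟩

theorem length_le_of_afterTail {K : ℕ} {l : List (ℕ × T)} (hl : l.Nodup)
    (h : AfterTail s K {y | y ∈ l}) : l.length ≤ K := by
  classical
  have h1 := h.1
  rw [show {y | y ∈ l} = (l.toFinset : Set (ℕ × T)) by ext; simp,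
    Set.encard_coe_eq_coe_finsetCard, List.toFinset_card_of_nodup hl] at h1
  exact_mod_cast h1

end
-- The entries of the linearization and their order
/-- The time when the returned item was inserted into the array. -/
noncomputable def outcomeTime {P T : Type*} (σ : ℕ → State P T) (o : Outcome T) : ℕ :=
  o.item?.elim 0 fun x => putTime σ x.1

/-- The entries of the inserted items. -/
def IsPushEntry {P T : Type*} (n : ℕ) (σ : ℕ → State P T) (lab : ℕ → P × Act T)
    (e : Entry T) : Prop :=
  ∃ j k a i pos, j < n ∧ (lab j).2 = .invPush k a i ∧ (σ n).array pos = some i ∧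
    e = ⟨j, .push (i, a), putTime σ i⟩

/-- The `pop` of `p` invoked by step `j` finishes its last scan with step `s`, and step `c`
determines its outcome `o`. -/
structure PopData {P T Q : Type*} [LinearOrder Q] (prio : T → Q) (n : ℕ) (σ : ℕ → State P T)
    (lab : ℕ → P × Act T) (p : P) (o : Outcome T) (j s c : ℕ) : Prop where
  lt : c < n
  decides : Decides σ lab p o c
  inv : (lab j).2 = .invPop
  openSince : OpenSince lab p j (c + 1)
  inv_lt : j < s
  lt_decides : s < c
  lastScan : LastScan σ lab p s (c + 1)
  justified : (PC.popReturn o).Justified prio (σ (s + 1)) p (σ (c + 1))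

/-- The entry of a `pop` whose outcome has been determined: it takes effect when it ends its last
scan, or, if the item it returns is inserted later, right after this insertion. -/
noncomputable def popEntry {P T : Type*} (σ : ℕ → State P T) (o : Outcome T) (j s : ℕ) : Entry T :=
  ⟨j, .pop o, max (s + 1) (outcomeTime σ o)⟩

/-- The entries of the linearization. -/
def IsEntry {P T Q : Type*} [LinearOrder Q] (prio : T → Q) (n : ℕ) (σ : ℕ → State P T)
    (lab : ℕ → P × Act T) (e : Entry T) : Prop :=
  IsPushEntry n σ lab e ∨ ∃ p o j s c, PopData prio n σ lab p o j s c ∧ e = popEntry σ o j s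

section
variable {P T Q : Type*} [LinearOrder Q] {prio : T → Q} {n : ℕ}
  {σ : ℕ → State P T} {lab : ℕ → P × Act T} {p : P} {o : Outcome T} {j s c : ℕ}

theorem PopData.isInv (d : PopData prio n σ lab p o j s c) : (lab j).2.IsInv := by
  rw [d.inv]
  trivial

theorem IsEntry.isPushEntry {e : Entry T} (he : IsEntry prio n σ lab e) {x : ℕ × T}
    (hx : e.op = .push x) : IsPushEntry n σ lab e := by
  rcases he with he | ⟨p, o, j, s, c, d, rfl⟩
  · exact he
  · cases hx

theorem IsEntry.popData {e : Entry T} (he : IsEntry prio n σ lab e)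
    (ho : e.op = .pop o) : ∃ p j s c, PopData prio n σ lab p o j s c ∧ e = popEntry σ o j s := by
  rcases he with ⟨j, k, a, i, pos, hj, hl, hi, rfl⟩ | ⟨p, o, j, s, c, d, rfl⟩
  · cases ho
  · obtain rfl : o = _ := by simpa [popEntry] using ho
    exact ⟨p, j, s, c, d, rfl⟩

end

section
variable {P T Q : Type*} [DecidableEq P] [LinearOrder Q] {prio : T → Q} {kmax n : ℕ}
  {σ : ℕ → State P T} {lab : ℕ → P × Act T} {p : P} {o : Outcome T} {j s c : ℕ}

theorem IsRun.exists_popData (h : IsRun prio kmax n σ lab) (hc : c < n)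
    (hd : Decides σ lab p o c) : ∃ j s, PopData prio n σ lab p o j s c := by
  obtain ⟨j, s, h1, h2, h3, h4, h5⟩ := h.exists_lastScan (p := p) (t := c + 1) hc
    (by rw [hd.2.2]; trivial)
  rw [hd.2.2] at h5
  refine ⟨j, s, hc, hd, h1, h2, h3, ?_, h4, h5⟩
  refine lt_of_le_of_ne (Nat.le_of_lt_succ h4.1) ?_
  -- A scan ends at `popSelect`, so it cannot be the step that reaches `popReturn`.
  rintro rfl
  have h6 := h4.2.1.2.2
  rw [hd.2.2] at h6
  cases h6

namespace PopData

/-- The returned item. -/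
theorem item (h : IsRun prio kmax n σ lab) (d : PopData prio n σ lab p o j s c) {i : ℕ} {a : T}
    (hi : o.item? = some (i, a)) :
    ∃ pos it, (σ c).array pos = some i ∧ (σ (c + 1)).heap i = some it ∧ it.task = a := by
  obtain ⟨⟨pos, h1⟩, -⟩ := h.take_of_decides d.lt d.decides hi
  have h2 := d.justified
  rcases o with _ | ⟨i', a'⟩ | ⟨i', a'⟩ <;> simp only [Outcome.item?, reduceCtorEq,
    Option.some.injEq, Prod.mk.injEq] at hi <;> obtain ⟨rfl, rfl⟩ := hi
  · obtain ⟨⟨r, -, -, it, h3, h4⟩, -⟩ := h2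
    exact ⟨pos, it, h1, h3, h4⟩
  · obtain ⟨-, -, it, -, h3, h4, -⟩ := h2
    exact ⟨pos, it, h1, h3, h4⟩

theorem outcomeTime_le (h : IsRun prio kmax n σ lab) (d : PopData prio n σ lab p o j s c) :
    outcomeTime σ o ≤ c := by
  rcases hi : o.item? with _ | ⟨i, a⟩
  · simp [outcomeTime, hi]
  · obtain ⟨pos, -, h1, -⟩ := d.item h hi
    simpa [outcomeTime, hi] using putTime_le h1

/-- The scan precedes the deciding step, and the CAS that takes an item finds it already in the
array. So the effect comes no later than the actual taking. -/
theorem pt_le (h : IsRun prio kmax n σ lab) (d : PopData prio n σ lab p o j s c) :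
    (popEntry σ o j s).pt ≤ c :=
  max_le d.lt_decides (d.outcomeTime_le h)

theorem eq_of_eq_decides (h : IsRun prio kmax n σ lab) (d : PopData prio n σ lab p o j s c)
    {p' : P} {o' : Outcome T} {j' s' : ℕ} (d' : PopData prio n σ lab p' o' j' s' c) :
    popEntry σ o j s = popEntry σ o' j' s' := by
  obtain rfl : p = p' := d.decides.1.symm.trans d'.decides.1
  have h1 := d.decides.2.2
  rw [d'.decides.2.2, PC.popReturn.injEq] at h1
  subst h1
  have h2 := d.openSince.1
  have h3 := d'.openSince.1
  obtain rfl := h.openSince_unique d.lt d.lt h2 h3 d.openSince d.isInv d'.openSince d'.isInv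
  obtain rfl := d.lastScan.unique d'.lastScan
  rfl

theorem eq_of_eq_inv (h : IsRun prio kmax n σ lab) (d : PopData prio n σ lab p o j s c)
    {p' : P} {o' : Outcome T} {s' c' : ℕ} (d' : PopData prio n σ lab p' o' j s' c') :
    popEntry σ o j s = popEntry σ o' j s' := by
  -- After the first decision the place stays at `popReturn` until its response, so the same `pop`
  -- cannot decide again.
  have key : ∀ {p p' : P} {o o' : Outcome T} {s s' c c' : ℕ}, PopData prio n σ lab p o j s c →
      PopData prio n σ lab p' o' j s' c' → ¬ c < c' := by
    intro p p' o o' s s' c c' d d' hlt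
    obtain rfl : p = p' := d.openSince.2.1.symm.trans d'.openSince.2.1
    have hj := d.openSince.1
    have hn := d'.lt
    have hr : ∀ l, c + 1 ≤ l → l < c' + 1 → (lab l).1 = p → ¬ (lab l).2.IsRet :=
      fun l hl hl' => d'.openSince.2.2 l (by omega) hl'
    have h1 := h.popReturn_mono (show c + 1 ≤ c' from hlt) (by omega) d.decides.2.2
      fun l hl hl' => hr l hl (by omega)
    have h2 := h.popReturn_mono (show c + 1 ≤ c' + 1 by omega) (by omega) d.decides.2.2 hr
    rw [d'.decides.2.2, PC.popReturn.injEq] at h2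
    subst h2
    exact d'.decides.2.1 h1
  obtain rfl : c = c' := le_antisymm (not_lt.1 (key d' d)) (not_lt.1 (key d d'))
  exact d.eq_of_eq_decides h d'

theorem eq_of_eq_scan (h : IsRun prio kmax n σ lab) (d : PopData prio n σ lab p o j s c)
    {p' : P} {o' : Outcome T} {j' c' : ℕ} (d' : PopData prio n σ lab p' o' j' s c') :
    popEntry σ o j s = popEntry σ o' j' s := by
  obtain rfl : p = p' := d.lastScan.2.1.1.symm.trans d'.lastScan.2.1.1
  have h1 := d.inv_lt
  have h2 := d'.inv_lt
  have h3 := d.lt_decides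
  have h4 := d'.lt_decides
  obtain rfl := h.openSince_unique d.lt d'.lt (by omega) (by omega) d.openSince d.isInv
    d'.openSince d'.isInv
  exact d.eq_of_eq_inv h d'

theorem eq_of_eq_item (h : IsRun prio kmax n σ lab) (d : PopData prio n σ lab p o j s c)
    {p' : P} {o' : Outcome T} {j' s' c' : ℕ} (d' : PopData prio n σ lab p' o' j' s' c')
    {i : ℕ} {a a' : T} (hi : o.item? = some (i, a)) (hi' : o'.item? = some (i, a')) :
    popEntry σ o j s = popEntry σ o' j' s' := by
  obtain rfl := h.take_unique d.lt d'.lt d.decides d'.decides hi hi'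
  exact d.eq_of_eq_decides h d'

end PopData

namespace IsRun

theorem eq_of_putTime_eq (h : IsRun prio kmax n σ lab) {pos pos' i i' : ℕ}
    (hi : (σ n).array pos = some i) (hi' : (σ n).array pos' = some i')
    (ht : putTime σ i = putTime σ i') : i = i' := by
  obtain ⟨u, -, h1, -, -, -, -, -, h2⟩ := h.exists_put le_rfl hi
  obtain ⟨u', -, h3, h4, -⟩ := h.exists_put le_rfl hi'
  obtain rfl : u = u' := by omega
  have h5 := h.array_putTime le_rfl hi
  have h6 := h.array_putTime le_rfl hi'
  rw [h1] at h5
  rw [h3] at h6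
  by_cases hpos : pos' = pos
  · subst hpos
    exact Option.some.inj (h5.symm.trans h6)
  · rw [h2 _ hpos] at h6
    exact absurd h6 (h4 _)

theorem putTime_ne_scan (h : IsRun prio kmax n σ lab) {pos i : ℕ}
    (hi : (σ n).array pos = some i) (hs : IsScan σ lab p s) : putTime σ i ≠ s + 1 := by
  intro ht
  obtain ⟨u, -, h1, -, -, -, h2, -⟩ := h.exists_put le_rfl hi
  obtain rfl : u = s := by omega
  rw [hs.1] at h2
  exact h2 hs.2.1

/-- The point of a `pop` marks either the end of a scan or an insertion, and no step is both. A scan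
belongs to one `pop`; an insertion concerns one item, which is taken by one `pop`. -/
theorem popEntry_eq_of_pt_eq (h : IsRun prio kmax n σ lab) (d : PopData prio n σ lab p o j s c)
    {p' : P} {o' : Outcome T} {j' s' c' : ℕ} (d' : PopData prio n σ lab p' o' j' s' c')
    (ht : (popEntry σ o j s).pt = (popEntry σ o' j' s').pt) :
    popEntry σ o j s = popEntry σ o' j' s' := by
  have harr : ∀ {p : P} {o : Outcome T} {j s c : ℕ}, PopData prio n σ lab p o j s c →
      s + 1 < outcomeTime σ o → ∃ i a pos, o.item? = some (i, a) ∧ outcomeTime σ o = putTime σ i ∧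
        (σ n).array pos = some i := by
    intro p o j s c d hlt
    rcases hi : o.item? with _ | ⟨i, a⟩
    · simp [outcomeTime, hi] at hlt
    · obtain ⟨pos, -, h1, -⟩ := d.item h hi
      exact ⟨i, a, pos, rfl, by simp [outcomeTime, hi], h.array_mono d.lt.le le_rfl h1⟩
  simp only [popEntry] at ht
  rcases le_or_gt (outcomeTime σ o) (s + 1) with h1 | h1 <;>
    rcases le_or_gt (outcomeTime σ o') (s' + 1) with h2 | h2
  · obtain rfl : s = s' := by omega
    exact d.eq_of_eq_scan h d'
  · obtain ⟨i, a, pos, -, h3, h4⟩ := harr d' h2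
    exact absurd (by omega) (h.putTime_ne_scan h4 d.lastScan.2.1)
  · obtain ⟨i, a, pos, -, h3, h4⟩ := harr d h1
    exact absurd (by omega) (h.putTime_ne_scan h4 d'.lastScan.2.1)
  · obtain ⟨i, a, pos, h3, h4, h5⟩ := harr d h1
    obtain ⟨i', a', pos', h6, h7, h8⟩ := harr d' h2
    obtain rfl := h.eq_of_putTime_eq h5 h8 (by omega)
    exact d.eq_of_eq_item h d' h3 h6

theorem pushEntry_eq (h : IsRun prio kmax n σ lab) {e e' : Entry T} {i : ℕ} {a a' : T}
    (he : IsPushEntry n σ lab e) (he' : IsPushEntry n σ lab e') (h1 : e.op = .push (i, a))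
    (h2 : e'.op = .push (i, a')) : e = e' := by
  obtain ⟨j, k, a, i, pos, hj, hl, -, rfl⟩ := he
  obtain ⟨j', k', a', i', pos', hj', hl', -, rfl⟩ := he'
  simp only [Op.push.injEq, Prod.mk.injEq] at h1 h2
  obtain ⟨rfl, rfl⟩ := h1
  obtain ⟨rfl, rfl⟩ := h2
  obtain rfl := h.invPush_unique hl hl' hj hj'
  rw [hl, Act.invPush.injEq] at hl'
  rw [hl'.2.1]

/-- The parity of the key separates `push` from `pop`; within each kind the linearization point
determines the operation. -/
theorem isEntry_eq_of_key_eq (h : IsRun prio kmax n σ lab) (e e' : Entry T)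
    (he : IsEntry prio n σ lab e) (he' : IsEntry prio n σ lab e') (hk : e.key = e'.key) :
    e = e' := by
  rcases he with he | ⟨p, o, j, s, c, d, rfl⟩ <;> rcases he' with he' | ⟨p', o', j', s', c', d', rfl⟩
  · have h1 := he
    have h2 := he'
    obtain ⟨j, k, a, i, pos, hj, hl, hi, rfl⟩ := h1
    obtain ⟨j', k', a', i', pos', hj', hl', hi', rfl⟩ := h2
    simp only [Entry.key] at hk
    obtain rfl := h.eq_of_putTime_eq hi hi' (by omega)
    exact h.pushEntry_eq he he' rfl rfl
  · obtain ⟨j, k, a, i, pos, hj, hl, hi, rfl⟩ := he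
    simp only [Entry.key, popEntry] at hk
    omega
  · obtain ⟨j, k, a, i, pos, hj, hl, hi, rfl⟩ := he'
    simp only [Entry.key, popEntry] at hk
    omega
  · refine h.popEntry_eq_of_pt_eq d d' ?_
    simp only [Entry.key, popEntry] at hk ⊢
    omega

theorem isEntry_eq_of_inv_eq (h : IsRun prio kmax n σ lab) (e e' : Entry T)
    (he : IsEntry prio n σ lab e) (he' : IsEntry prio n σ lab e') (hk : e.inv = e'.inv) :
    e = e' := by
  rcases he with he | ⟨p, o, j, s, c, d, rfl⟩ <;> rcases he' with he' | ⟨p', o', j', s', c', d', rfl⟩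
  · obtain ⟨j, k, a, i, pos, hj, hl, hi, rfl⟩ := he
    obtain ⟨j', k', a', i', pos', hj', hl', hi', rfl⟩ := he'
    obtain rfl : j = j' := hk
    rw [hl, Act.invPush.injEq] at hl'
    rw [hl'.2.1, hl'.2.2]
  · obtain ⟨j, k, a, i, pos, hj, hl, hi, rfl⟩ := he
    obtain rfl : j = j' := hk
    rw [d'.inv] at hl
    cases hl
  · obtain ⟨j', k, a, i, pos, hj, hl, hi, rfl⟩ := he'
    obtain rfl : j = j' := hk
    rw [d.inv] at hl
    cases hl
  · obtain rfl : j = j' := hk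
    exact d.eq_of_eq_inv h d'

theorem pt_le_of_isEntry (h : IsRun prio kmax n σ lab) {e : Entry T}
    (he : IsEntry prio n σ lab e) : e.pt ≤ n := by
  rcases he with ⟨j, k, a, i, pos, hj, hl, hi, rfl⟩ | ⟨p, o, j, s, c, d, rfl⟩
  · exact putTime_le hi
  · exact (d.pt_le h).trans d.lt.le

theorem exists_linearization (h : IsRun prio kmax n σ lab) :
    ∃ L : List (Entry T), (∀ e, e ∈ L ↔ IsEntry prio n σ lab e) ∧
      L.Pairwise (fun e e' => e.key < e'.key) := by
  -- Points are at most n, so keys are at most 2n + 1.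
  refine exists_sorted_list _ Entry.key (2 * n + 2) (fun e he => ?_) h.isEntry_eq_of_key_eq
  have h1 := h.pt_le_of_isEntry he
  rcases hop : e.op with x | o
  · rw [Entry.key_of_push hop]
    omega
  · rw [Entry.key_of_pop hop]
    omega

end IsRun

/-! ### Legality, and the location of the ignored elements -/

section
variable {L L₁ L₂ : List (Entry T)} {e : Entry T}

/-- Addresses are fresh, so no element is pushed twice. A `pop` never takes effect before the
insertion of its item, the parity of the keys breaks the tie in favour of the `push`, and no other
`pop` takes the same item. -/
theorem IsRun.legal (h : IsRun prio kmax n σ lab) (hL : ∀ e, e ∈ L ↔ IsEntry prio n σ lab e)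
    (hs : L.Pairwise (fun e e' => e.key < e'.key)) : Legal (L.map Entry.op) := by
  intro M₁ op M₂ hM
  obtain ⟨L₁, L', rfl, rfl, hL'⟩ := List.map_eq_append_iff.1 hM
  obtain ⟨e, L₂, rfl, rfl, rfl⟩ := List.map_eq_cons_iff.1 hL'
  have hmem : ∀ e', e' ∈ L₁ ↔ IsEntry prio n σ lab e' ∧ e'.key < e.key := fun e' => by
    rw [mem_left_iff hs rfl, hL]
  have he : IsEntry prio n σ lab e := (hL e).1 (by simp)
  rcases hop : e.op with ⟨i, a⟩ | o
  · simp only [mem_pushed]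
    rintro ⟨e', he', hop'⟩
    obtain ⟨h1, h2⟩ := (hmem e').1 he'
    rw [h.pushEntry_eq (h1.isPushEntry hop') (he.isPushEntry hop) hop' hop] at h2
    omega
  · rintro ⟨i, a⟩ hi
    obtain ⟨p, j, s, c, d, rfl⟩ := he.popData hop
    obtain ⟨pos, it, h1, h2, h3⟩ := d.item h hi
    have hc := d.lt
    obtain ⟨j', h4, h5⟩ := h.exists_alloc (t := c + 1) hc h2
    have h6 : IsPushEntry n σ lab ⟨j', .push (i, a), putTime σ i⟩ :=
      ⟨j', _, _, i, pos, by omega, h5, h.array_mono hc.le le_rfl h1, by rw [h3]⟩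
    refine mem_contents ⟨_, (hmem _).2 ⟨.inl h6, ?_⟩, rfl⟩ fun e' he' o' ho' hi' => ?_
    · have h7 : outcomeTime σ o = putTime σ i := by simp [outcomeTime, hi]
      simp only [Entry.key, popEntry, h7]
      omega
    · obtain ⟨h7, h8⟩ := (hmem e').1 he'
      obtain ⟨p', j', s', c', d', rfl⟩ := h7.popData ho'
      rw [d.eq_of_eq_item h d' hi hi'] at h8
      omega

/-- A pushed element is in the array. -/
theorem IsRun.array_of_mem_pushed (h : IsRun prio kmax n σ lab) {e₀ : Entry T} {y : ℕ × T} {t : ℕ}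
    (ht : t ≤ n) (he : IsEntry prio n σ lab e₀) (hy : e₀.op = .push y) (het : e₀.pt ≤ t) :
    ∃ pos it, e₀.pt = putTime σ y.1 ∧ (σ t).array pos = some y.1 ∧ (σ t).heap y.1 = some it ∧
      it.task = y.2 := by
  obtain ⟨j, k, a, i, pos, hj, hl, hi, rfl⟩ := he.isPushEntry hy
  simp only [Op.push.injEq] at hy
  subst hy
  have h1 := h.array_mono het ht (h.array_putTime le_rfl hi)
  obtain ⟨it, h2, -⟩ := (h.wf ht).item _ _ h1
  obtain ⟨it', h3, -, h4⟩ := h.heap_of_invPush hl (h.lt_of_heap hl hj h2) ht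
  exact ⟨pos, it', rfl, h1, h3, h4⟩

/-- If the item were already taken, the `pop` that took it would have its point no later than the
taking and no earlier than the insertion. It would lie between the `push` and the present entry, so
the element would no longer be stored. -/
theorem IsRun.array_of_mem_contents (h : IsRun prio kmax n σ lab)
    (hL : ∀ e, e ∈ L ↔ IsEntry prio n σ lab e) (hs : L.Pairwise (fun e e' => e.key < e'.key))
    (hsplit : L = L₁ ++ e :: L₂) {y : ℕ × T} (hy : y ∈ contents (L₁.map Entry.op)) :
    ∃ pos it, (σ e.pt).array pos = some y.1 ∧ (σ e.pt).heap y.1 = some it ∧ it.task = y.2 ∧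
      ¬ (σ e.pt).Taken y.1 := by
  have hmem : ∀ e', e' ∈ L₁ ↔ IsEntry prio n σ lab e' ∧ e'.key < e.key := fun e' => by
    rw [mem_left_iff hs hsplit, hL]
  have hpt : e.pt ≤ n := h.pt_le_of_isEntry ((hL e).1 (by simp [hsplit]))
  have hs₁ : L₁.Pairwise (fun e e' => e.key < e'.key) := by
    rw [hsplit, List.pairwise_append] at hs
    exact hs.1
  obtain ⟨A, e₀, B, rfl, h1, h2⟩ := exists_of_mem_contents hy
  obtain ⟨h3, h4⟩ := (hmem e₀).1 (by simp)
  have h5 : e₀.pt ≤ e.pt := by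
    rw [Entry.key_of_push h1] at h4
    simp only [Entry.key] at h4
    split at h4 <;> omega
  obtain ⟨pos, it, h6, h7, h8, h9⟩ := h.array_of_mem_pushed hpt h3 h1 h5
  refine ⟨pos, it, h7, h8, h9, fun hT => ?_⟩
  obtain ⟨c, h10, ⟨o, a, h11, h12⟩, h13⟩ := h.exists_take hpt h7 hT
  obtain ⟨j, s, d⟩ := h.exists_popData (by omega) h11
  obtain ⟨pos', it', -, h14, h15⟩ := d.item h h12
  obtain ⟨it'', h16, -, -, h17⟩ := h.heap_mono (show c + 1 ≤ e.pt from h10) hpt _ _ h14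
  obtain rfl : it'' = it := by simpa [h8] using h16.symm
  have h18 : y.2 = a := by rw [← h9, h17, h15]
  have h19 := d.pt_le h
  have h20 : (popEntry σ o j s).key = 2 * (popEntry σ o j s).pt + 1 := rfl
  have h21 : putTime σ y.1 ≤ (popEntry σ o j s).pt := by
    simp [popEntry, outcomeTime, h12]
  -- If this point equals the insertion time, the odd key still puts the `pop` behind the `push`.
  refine h2 (popEntry σ o j s) (mem_right_of_lt hs₁ ((hmem _).2 ⟨.inr ⟨_, _, _, _, _, d, rfl⟩, ?_⟩)
    ?_) o rfl (by rw [h12, ← h18])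
  · simp only [Entry.key] at h20 ⊢
    omega
  · rw [h20, Entry.key_of_push h1]
    omega

/-- An element that a `pop` ignores is stored after `tail`, if `tail` does not change between its
last scan and its linearization point. -/
theorem IsRun.tail_le_of_mem_ignored (h : IsRun prio kmax n σ lab)
    (hL : ∀ e, e ∈ L ↔ IsEntry prio n σ lab e) (hs : L.Pairwise (fun e e' => e.key < e'.key))
    (hsplit : L = L₁ ++ popEntry σ o j s :: L₂) (d : PopData prio n σ lab p o j s c)
    (htail : (σ (popEntry σ o j s).pt).tail = (σ (s + 1)).tail) {y : ℕ × T}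
    (hy : y ∈ ignored prio (L₁.map Entry.op) o) :
    ∃ pos it, (σ (popEntry σ o j s).pt).tail ≤ pos ∧
      pos < (σ (popEntry σ o j s).pt).tail + it.k ∧
      (σ (popEntry σ o j s).pt).array pos = some y.1 ∧
      (σ (popEntry σ o j s).pt).heap y.1 = some it ∧ it.task = y.2 := by
  obtain ⟨pos, it, h1, h2, h3, h4⟩ := h.array_of_mem_contents hL hs hsplit hy.1
  have hsc := d.lastScan.2.1
  have hpt : (popEntry σ o j s).pt ≤ n := (d.pt_le h).trans d.lt.le
  have hst : s + 1 ≤ (popEntry σ o j s).pt := le_max_left _ _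
  have hw := h.wf (t := s + 1) (by omega)
  refine ⟨pos, it, ?_, ?_, h1, h2, h3⟩
  -- Before the `tail` of the scan the array is full and never overwritten, so the element was
  -- already there and untaken. The head has reached `tail` and the program counter is at
  -- `popSelect`, so the invariant leaves only the queue as its whereabouts.
  · by_contra hlt
    rw [htail, not_le] at hlt
    have hhead := ((hsc.1 ▸ h.2 s (by omega) :
      Step prio kmax (σ s) p (lab s).2 (σ (s + 1))).of_scan hsc.2.1 hsc.2.2).1
    obtain ⟨i, h5⟩ := Option.ne_none_iff_exists'.1 (hw.full pos hlt)
    obtain rfl : i = y.1 := by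
      have h6 := h.array_mono hst hpt h5
      rw [h1] at h6
      exact (Option.some.inj h6).symm
    obtain ⟨it', h6, h7, -⟩ := hw.item _ _ h5
    obtain ⟨it'', h8, -, -, h9⟩ := h.heap_mono hst hpt _ _ h6
    obtain rfl : it'' = it := by simpa [h2] using h8.symm
    have h10 : it'.tag = (pos : ℤ) := h7.resolve_right fun h11 =>
      h4 (h.taken_mono hst hpt h5 ⟨it', h6, h11⟩)
    have h12 := hw.cover p pos y.1 it' h5 h6 h10 (.inl (by omega))
    simp only [hsc.2.2, reduceCtorEq, exists_false, or_false] at h12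
    have h13 := d.justified
    rcases o with _ | ⟨i, a⟩ | ⟨i, a⟩ <;> simp only [PC.Justified] at h13
    · simp [h13] at h12
    · have h14 := h13.2 _ h12 it' h6
      have h15 := hy.2 (i, a) rfl
      rw [← h3, h9] at h15
      exact absurd h14 (not_le.2 h15)
    · simp [h13.1] at h12
  · obtain ⟨it', h5, -, h6⟩ := (h.wf hpt).item _ _ h1
    obtain rfl : it' = it := by simpa [h2] using h5.symm
    exact h6

/-- A queued item is already in the array when the scan ends, and for null the insertion time is 0
by convention; so the maximum is attained by the scan. -/
theorem PopData.pt_eq_of_notProbe (d : PopData prio n σ lab p o j s c)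
    (h : IsRun prio kmax n σ lab) (ho : o.NotProbe) : (popEntry σ o j s).pt = s + 1 := by
  have hsn := d.lt_decides
  have hc := d.lt
  refine max_eq_left ?_
  rcases o with _ | ⟨i, a⟩ | ⟨i, a⟩
  · simp [outcomeTime, Outcome.item?]
  · obtain ⟨⟨r, h1, rfl, -⟩, -⟩ := d.justified
    exact putTime_le ((h.wf (t := s + 1) (by omega)).queue p r h1)
  · exact ho.elim

theorem IsRun.param_eq (h : IsRun prio kmax n σ lab) {k t i : ℕ} (hk : UniformK n lab k)
    (ht : t ≤ n) {it : Item P T} (hi : (σ t).heap i = some it) : it.k = k := by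
  obtain ⟨j, h1, h2⟩ := h.exists_alloc ht hi
  exact hk j (by omega) _ _ _ h2

theorem Step.tail_cases {s s' : State P T} {act : Act T} (h : Step prio kmax s p act s') :
    s'.tail = s.tail ∨ ∃ i it, s.heap i = some it ∧ s'.tail = s.tail + it.k := by
  cases h
  case pushTailOk i t it hpc hi ht => exact .inr ⟨i, it, hi, by rw [ht]; rfl⟩
  all_goals exact .inl rfl

theorem IsRun.dvd_tail (h : IsRun prio kmax n σ lab) {k t : ℕ} (hk : UniformK n lab k)
    (ht : t ≤ n) : k ∣ (σ t).tail := by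
  induction t with
  | zero => simp [h.1, State.init]
  | succ t ih =>
    rcases (h.2 t ht).tail_cases with h1 | ⟨i, it, h1, h2⟩
    · rw [h1]
      exact ih (by omega)
    · rw [h2, h.param_eq hk (by omega) h1]
      exact (ih (by omega)).add (dvd_refl k)

/-- With a uniform parameter, `tail` does not change between the last scan of a `pop` and its
linearization point. -/
theorem PopData.tail_eq (d : PopData prio n σ lab p o j s c) (h : IsRun prio kmax n σ lab)
    {k : ℕ} (hk : UniformK n lab k) :
    (σ (popEntry σ o j s).pt).tail = (σ (s + 1)).tail := by
  by_cases ho : o.NotProbe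
  · rw [d.pt_eq_of_notProbe h ho]
  rcases le_or_gt (outcomeTime σ o) (s + 1) with hle | hlt
  · rw [show (popEntry σ o j s).pt = s + 1 from max_eq_left hle]
  have hpt : (popEntry σ o j s).pt = outcomeTime σ o := max_eq_right hlt.le
  rcases o with _ | ⟨i, a⟩ | ⟨i, a⟩
  · exact absurd trivial ho
  · exact absurd trivial ho
  rw [hpt]
  replace hlt : s + 1 < putTime σ i := hlt
  change (σ (putTime σ i)).tail = _
  have hc := d.lt
  have hsc := d.lastScan.2.1
  obtain ⟨-, pos, it, h1, h2, -, h3, h4⟩ := d.justified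
  rw [h.param_eq hk (by omega) h2] at h4
  obtain ⟨u, hu, h5, -, h6, h7, -⟩ := h.exists_put (t := c + 1) hc h1
  rw [h5] at hlt ⊢
  -- The position is still null just before the insertion, so `tail` has not passed it. As `pos` is
  -- less than `head + k`, and `head` is at most the `tail` of the scan, `tail` has advanced by less
  -- than k.
  have h8 : (σ u).tail ≤ pos := by
    by_contra hlt'
    exact (h.wf (by omega)).full pos (not_le.1 hlt') h6
  have h9 := ((hsc.1 ▸ h.2 s (by omega) :
    Step prio kmax (σ s) p (lab s).2 (σ (s + 1))).of_scan hsc.2.1 hsc.2.2).1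
  have h10 := (h.wf (t := s + 1) (by omega)).head_le p
  refine (eq_of_dvd_of_lt_add (h.dvd_tail hk (by omega)) (h.dvd_tail hk (by omega))
    (h.tail_mono hlt.le (by omega)) ?_).symm
  rw [h7]
  omega

/-- With a uniform parameter, a pushed element that is stored after `tail` is recent. -/
theorem IsRun.mem_rtake_pushed (h : IsRun prio kmax n σ lab)
    (hL : ∀ e, e ∈ L ↔ IsEntry prio n σ lab e) (hs : L.Pairwise (fun e e' => e.key < e'.key))
    (hsplit : L = L₁ ++ e :: L₂) {k : ℕ} (hk : UniformK n lab k) {y : ℕ × T} {pos : ℕ}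
    (hy : y ∈ pushed (L₁.map Entry.op)) (ha : (σ e.pt).array pos = some y.1)
    (hpos : (σ e.pt).tail ≤ pos) : y ∈ (pushed (L₁.map Entry.op)).rtake k := by
  have hmem : ∀ e', e' ∈ L₁ ↔ IsEntry prio n σ lab e' ∧ e'.key < e.key := fun e' => by
    rw [mem_left_iff hs hsplit, hL]
  have hpt : e.pt ≤ n := h.pt_le_of_isEntry ((hL e).1 (by simp [hsplit]))
  have hs₁ : L₁.Pairwise (fun e e' => e.key < e'.key) := by
    rw [hsplit, List.pairwise_append] at hs
    exact hs.1
  have hnd : (pushed (L₁.map Entry.op)).Nodup := by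
    refine nodup_pushed hs₁ fun e₁ he₁ e₂ he₂ x h1 h2 => ?_
    exact h.pushEntry_eq (((hmem _).1 he₁).1.isPushEntry h1) (((hmem _).1 he₂).1.isPushEntry h2)
      h1 h2
  obtain ⟨e₀, he₀, hop⟩ := mem_pushed.1 hy
  obtain ⟨A, B, rfl⟩ := List.append_of_mem he₀
  have hle : ∀ e' ∈ A ++ e₀ :: B, ∀ x, e'.op = .push x → e'.pt ≤ e.pt := by
    intro e' he' x hx
    have h1 := ((hmem e').1 he').2
    rw [Entry.key_of_push hx] at h1
    simp only [Entry.key] at h1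
    split at h1 <;> omega
  have hsuf : ∀ e' ∈ e₀ :: B, e₀.key ≤ e'.key := by
    rw [List.pairwise_append, List.pairwise_cons] at hs₁
    intro e' he'
    rcases List.mem_cons.1 he' with rfl | he'
    · exact le_rfl
    · exact (hs₁.2.1.1 _ he').le
  -- Every item enters the array in the block of k positions that starts at the `tail` of that
  -- moment.
  have hkey : ∀ {x pos}, (σ e.pt).array pos = some x → putTime σ x ≤ e.pt ∧
      (σ (putTime σ x)).tail ≤ pos ∧ pos < (σ (putTime σ x)).tail + k := by
    intro x pos hx
    have h1 := h.array_putTime hpt hx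
    have h2 := putTime_le hx
    obtain ⟨it, h3, -, h4⟩ := (h.wf (t := putTime σ x) (by omega)).item _ _ h1
    rw [h.param_eq hk (by omega) h3] at h4
    obtain ⟨u, hu, h5, -, h6, h7, -⟩ := h.exists_put hpt hx
    refine ⟨h2, ?_, h4⟩
    rw [h5, h7]
    by_contra hlt
    exact (h.wf (by omega)).full pos (not_le.1 hlt) h6
  obtain ⟨h1, h2, h3⟩ := hkey ha
  -- The position of `y` lies in the block of its insertion and still after the present `tail`, so
  -- the two values of `tail` differ by less than k.
  have h4 : (σ (putTime σ y.1)).tail = (σ e.pt).tail :=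
    eq_of_dvd_of_lt_add (h.dvd_tail hk (by omega)) (h.dvd_tail hk hpt) (h.tail_mono h1 hpt)
      (by omega)
  rw [pushed_split hop] at hnd ⊢
  -- Whatever was pushed from `y` on was inserted while `tail` had this same value, hence into the
  -- same k positions.
  refine mem_rtake (length_le_of_afterTail (s := σ e.pt) hnd.of_append_right
    (afterTail_of_forall fun z hz => ?_))
  obtain ⟨e₁, he₁, hop₁⟩ : ∃ e₁ ∈ e₀ :: B, e₁.op = .push z := by
    rcases List.mem_cons.1 hz with rfl | hz
    · exact ⟨e₀, by simp, hop⟩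
    · obtain ⟨e₁, he₁, hop₁⟩ := mem_pushed.1 hz
      exact ⟨e₁, by simp [he₁], hop₁⟩
  have he₁' : e₁ ∈ A ++ e₀ :: B := List.mem_append_right A he₁
  obtain ⟨pos₀, -, h5, -⟩ := h.array_of_mem_pushed hpt ((hmem _).1 he₀).1 hop (hle _ he₀ _ hop)
  obtain ⟨pos₁, it, h6, h7, h8, h9⟩ :=
    h.array_of_mem_pushed hpt ((hmem _).1 he₁').1 hop₁ (hle _ he₁' _ hop₁)
  have h10 := hsuf e₁ he₁
  rw [Entry.key_of_push hop, Entry.key_of_push hop₁] at h10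
  obtain ⟨h11, h12, h13⟩ := hkey h7
  have h14 := h.tail_mono h11 hpt
  have h15 := h.tail_mono (show putTime σ y.1 ≤ putTime σ z.1 by omega) (by omega)
  exact ⟨pos₁, it, by omega, by omega, h7, h8, h9⟩

theorem IsRun.isLinearization (h : IsRun prio kmax n σ lab)
    (hL : ∀ e, e ∈ L ↔ IsEntry prio n σ lab e) (hs : L.Pairwise (fun e e' => e.key < e'.key)) :
    IsLinearization n lab L where
  legal := h.legal hL hs
  sorted := hs.imp fun {e e'} hlt => by
    simp only [Entry.key] at hlt
    split at hlt <;> split at hlt <;> omega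
  nodup := by
    rw [List.Nodup, List.pairwise_map]
    refine hs.imp_of_mem fun {e e'} he he' hlt heq => ?_
    rw [h.isEntry_eq_of_inv_eq e e' ((hL e).1 he) ((hL e').1 he') heq] at hlt
    omega
  invoked e he := by
    rw [hL] at he
    refine ⟨?_, h.pt_le_of_isEntry he, ?_⟩
    · rcases he with ⟨j, k, a, i, pos, hj, hl, hi, rfl⟩ | ⟨p, o, j, s, c, d, rfl⟩
      · have h1 := putTime_le hi
        obtain ⟨it, h2, -⟩ := (h.wf h1).item _ _ (h.array_putTime le_rfl hi)
        exact h.lt_of_heap hl hj h2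
      · exact lt_max_of_lt_left (Nat.lt_succ_of_lt d.inv_lt)
    · rcases he with ⟨j, k, a, i, pos, hj, hl, hi, rfl⟩ | ⟨p, o, j, s, c, d, rfl⟩
      · exact ⟨k, hl⟩
      · exact d.inv
  responded e he m hm hr := by
    rw [hL] at he
    obtain ⟨hjm, hp, hret, hno⟩ := hr
    rcases he with ⟨j, k, a, i, pos, hj, hl, hi, rfl⟩ | ⟨p, o, j, s, c, d, rfl⟩
    · refine ⟨?_, fun o ho => by cases ho⟩
      have ho : OpenSince lab (lab j).1 j m := ⟨hjm, rfl, hno⟩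
      have hji : (lab j).2.IsInv := by
        change (lab j).2 = _ at hl
        rw [hl]
        trivial
      have hst := h.2 m hm
      rw [show (lab m).1 = (lab j).1 from hp] at hst
      rcases hst.pc_of_isRet hret with ⟨-, i', pos', h1⟩ | ⟨o, -, h1⟩
      · obtain ⟨j', k', a', h2, h3⟩ := h.exists_invPush (i := i') hm.le (by rw [h1]; rfl)
        obtain rfl := h.openSince_unique hm.le hm.le ho.1 h3.1 ho hji h3 (by rw [h2]; trivial)
        rw [hl, Act.invPush.injEq] at h2
        rw [← h2.2.2] at h1
        exact (putTime_le ((h.wf hm.le).pushRef _ _ _ h1).1).trans (Nat.le_succ m)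
      · obtain ⟨j', h2, h3⟩ := h.exists_invPop (p := (lab j).1) hm.le (by rw [h1]; trivial)
        obtain rfl := h.openSince_unique hm.le hm.le ho.1 h3.1 ho hji h3 (by rw [h2]; trivial)
        rw [hl] at h2
        cases h2
    · obtain rfl : (lab j).1 = p := d.openSince.2.1
      -- There is no response between the invocation and the deciding step.
      have hcm : c < m := by
        by_contra hlt
        exact d.openSince.2.2 m hjm (by omega) hp hret
      refine ⟨(d.pt_le h).trans (by omega), fun o' ho' => ?_⟩
      obtain rfl : o = o' := by simpa [popEntry] using ho'
      have hjc := d.openSince.1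
      have h1 := h.popReturn_mono (show c + 1 ≤ m from hcm) hm.le d.decides.2.2
        fun l hl hl' => hno l (by simp only [popEntry]; omega) hl'
      have hst := h.2 m hm
      rw [show (lab m).1 = (lab j).1 from hp] at hst
      rcases hst.pc_of_isRet hret with ⟨-, i', pos', h2⟩ | ⟨o', h2, h3⟩
      · rw [h1] at h2
        cases h2
      · rw [h1, PC.popReturn.injEq] at h3
        rw [h2, h3]
  complete j m hm hr hj := by
    obtain ⟨hjm, hp, hret, hno⟩ := hr
    have hji : (lab j).2.IsInv := by
      rcases hj with hj | ⟨k, a, i, hj⟩ <;> rw [hj] <;> trivial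
    have ho : OpenSince lab (lab j).1 j m := ⟨hjm, rfl, hno⟩
    have hst := h.2 m hm
    rw [hp] at hst
    rcases hst.pc_of_isRet hret with ⟨-, i, pos, h1⟩ | ⟨o, -, h1⟩
    · obtain ⟨j', k', a', h2, h3⟩ := h.exists_invPush (i := i) hm.le (by rw [h1]; rfl)
      obtain rfl := h.openSince_unique hm.le hm.le ho.1 h3.1 ho hji h3 (by rw [h2]; trivial)
      have h4 := ((h.wf hm.le).pushRef _ _ _ h1).1
      exact ⟨_, (hL _).2 (.inl ⟨j, k', a', i, pos, by omega, h2, h.array_mono hm.le le_rfl h4, rfl⟩),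
        rfl⟩
    -- The place makes no step between its decision and this response, so the `pop` that decides at
    -- `c` is still open at `m` and is the one invoked by `j`.
    · obtain ⟨c, h2, h3, h4⟩ := h.exists_decides hm.le h1
      obtain ⟨j', s, d⟩ := h.exists_popData (by omega) h3
      have h5 := d.openSince.1
      have h6 : OpenSince lab (lab j).1 j' m := by
        refine ⟨by omega, d.openSince.2.1, fun l hl hl' hp' => ?_⟩
        rcases Nat.lt_or_ge c l with hcl | hcl
        · exact absurd hp' (h4 l hcl hl')
        · exact d.openSince.2.2 l hl (by omega) hp'
      obtain rfl := h.openSince_unique hm.le hm.le ho.1 h6.1 ho hji h6 d.isInv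
      exact ⟨_, (hL _).2 (.inr ⟨_, _, _, _, _, d, rfl⟩), rfl⟩

end

end

end CentralK

/-! ### The theorem -/

theorem theorem2 {P T Q : Type*} [Fintype P] [DecidableEq P] [LinearOrder Q]
    (prio : T → Q) (kmax : ℕ) (hkmax : 1 ≤ kmax) :
    CentralK.PopLockFree (P := P) prio kmax ∧
    ∀ (n : ℕ) (σ : ℕ → CentralK.State P T) (lab : ℕ → P × CentralK.Act T),
      CentralK.IsRun prio kmax n σ lab →
      ∃ L : List (CentralK.Entry T),
        CentralK.IsLinearization n lab L ∧
        (∀ L₁ e L₂ o, L = L₁ ++ e :: L₂ → e.op = CentralK.Op.pop o → o.NotProbe →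
          CentralK.AfterTail (σ e.pt) kmax
            (CentralK.ignored prio (L₁.map CentralK.Entry.op) o)) ∧
        (∀ k, CentralK.UniformK n lab k →
          ∀ L₁ e L₂ o, L = L₁ ++ e :: L₂ → e.op = CentralK.Op.pop o →
            CentralK.AfterTail (σ e.pt) k
              (CentralK.ignored prio (L₁.map CentralK.Entry.op) o) ∧
            ∀ y ∈ CentralK.ignored prio (L₁.map CentralK.Entry.op) o,
              y ∈ (CentralK.pushed (L₁.map CentralK.Entry.op)).rtake k) := by
  refine ⟨CentralK.popLockFree prio hkmax, fun n σ lab h => ?_⟩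
  obtain ⟨L, hL, hs⟩ := h.exists_linearization
  refine ⟨L, h.isLinearization hL hs, fun L₁ e L₂ o hsplit hop ho => ?_,
    fun k hk L₁ e L₂ o hsplit hop => ?_⟩
  · have he := (hL e).1 (by simp [hsplit])
    obtain ⟨p, j, s, c, d, rfl⟩ := he.popData hop
    refine CentralK.afterTail_of_forall fun y hy => ?_
    -- The bound is by the parameter of the ignored item itself, which is at most `kmax`.
    obtain ⟨pos, it, h1, h2, h3, h4, h5⟩ := h.tail_le_of_mem_ignored hL hs hsplit d
      (by rw [d.pt_eq_of_notProbe h ho]) hy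
    have h6 := ((h.wf (h.pt_le_of_isEntry he)).param _ _ h4).2
    exact ⟨pos, it, h1, by omega, h3, h4, h5⟩
  · have he := (hL e).1 (by simp [hsplit])
    obtain ⟨p, j, s, c, d, rfl⟩ := he.popData hop
    have key := fun y => h.tail_le_of_mem_ignored hL hs hsplit d (d.tail_eq h hk) (y := y)
    refine ⟨CentralK.afterTail_of_forall fun y hy => ?_, fun y hy => ?_⟩
    · obtain ⟨pos, it, h1, h2, h3, h4, h5⟩ := key y hy
      rw [h.param_eq hk (h.pt_le_of_isEntry he) h4] at h2
      exact ⟨pos, it, h1, h2, h3, h4, h5⟩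
    · obtain ⟨pos, it, h1, -, h3, -⟩ := key y hy
      refine h.mem_rtake_pushed hL hs hsplit hk ?_ h3 h1
      obtain ⟨A, e₀, B, rfl, h6, -⟩ := CentralK.exists_of_mem_contents hy.1
      exact CentralK.mem_pushed.2 ⟨e₀, by simp, h6⟩
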